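/- Let $1\le N_e<N_m$ be integers and let $B_1,P_v,P_m,\sigma_{vm},\sigma_{ve}>0$. Let the main channels $\mathbf h_{vm}\in\mathbb C^{N_m}$ and $\mathbf H_{mm}\in\mathbb C^{N_m\times N_m}$ be known (fixed), and let $\mathbf G_u\in\mathbb C^{N_m\times(N_m-1)}$ have orthonormal columns and satisfy $\mathbf h_{vm}^\dagger\mathbf H_{mm}\mathbf G_u=\mathbf 0$. Let the wiretap channels $\mathbf h_{ve}\in\mathbb C^{N_e}$ and $\mathbf H_{me}\in\mathbb C^{N_e\times N_m}$ be random with all entries mutually independent and $\mathcal{CN}(0,1)$-distributed, and put $\mathbf H_1=\mathbf H_{me}\mathbf G_u$. Define the main and wiretap capacities $$C_{v,u}=B_1\log_2\Big(1+\tfrac{P_v}{\sigma_{vm}^2}|\mathbf h_{vm}|^2\Big),$$ $$C_{e,u}=B_1\log_2\det\Big(\mathbf I_{N_e}+P_v\mathbf h_{ve}\mathbf h_{ve}^\dagger\big(\sigma_{ve}^2\mathbf I_{N_e}+\tfrac{P_m}{N_m-1}\mathbf H_1\mathbf H_1^\dagger\big)^{-1}\Big),$$ the secrecy rate $R_1=[C_{v,u}-C_{e,u}]^+$,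 and, for a wiretap code rate $R_u$, the secrecy outage probability $P_{\rm out}(R_u)=P(R_1\le R_u)$ and the effective secrecy rate $\hat R_u(R_u)=(1-P_{\rm out}(R_u))R_u$. Put $$a_1=\frac{\sigma_{ve}^2(N_m-1)}{P_m},\qquad Z_1=\mathbf h_{ve}^\dagger(a_1\mathbf I_{N_e}+\mathbf H_1\mathbf H_1^\dagger)^{-1}\mathbf h_{ve},\qquad \phi_1=\frac{P_m}{P_v(N_m-1)}\big(2^{(C_{v,u}-R_u)/B_1}-1\big),$$ $$F_{Z_1}(z)=e^{-a_1z}\sum_{k=0}^{N_e-1}\frac{A_k(z)}{k!}(a_1z)^k,\qquad A_k(z)=\frac{\sum_{n=0}^{N_e-k-1}\binom{N_m-1}{n}z^n}{(1+z)^{N_m-1}}.$$ Then $F_{Z_1}$ is the complementary cumulative distribution function of $Z_1$: $P(Z_1>z)=P(Z_1\ge z)=F_{Z_1}(z)$ for all $z\ge0$. Moreover, for every $R_u$ with $0\le R_u\le C_{v,u}$, $$P_{\rm out}(R_u)=P(C_{e,u}\ge C_{v,u}-R_u)=F_{Z_1}(\phi_1)\qquad\text{and}\qquad \hat R_u(R_u)=\big(1-F_{Z_1}(\phi_1)\big)R_u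 .$$ -/

import Mathlib

open MeasureTheory ProbabilityTheory
open scoped Matrix NNReal

namespace UplinkSecrecy

noncomputable section

/-- The standard circularly symmetric complex Gaussian law `CN(0,1)`: independent real and
imaginary parts, each with law `N(0, 1/2)`. -/
def stdComplexGaussian : Measure ℂ :=
  ((gaussianReal 0 (1 / 2 : ℝ≥0)).prod (gaussianReal 0 (1 / 2 : ℝ≥0))).map
    (fun p : ℝ × ℝ => (p.1 : ℂ) + (p.2 : ℂ) * Complex.I)

/-- All the entries of the random vector `hve` and of the random matrix `Hme`, taken together. -/
def channelEntry {Ω : Type*} {Ne Nm : ℕ} (hve : Ω → Fin Ne → ℂ)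
    (Hme : Ω → Matrix (Fin Ne) (Fin Nm) ℂ) :
    Fin Ne ⊕ (Fin Ne × Fin Nm) → Ω → ℂ
  | Sum.inl i => fun ω => hve ω i
  | Sum.inr p => fun ω => Hme ω p.1 p.2

/-- Rayleigh fading of the wiretap channels: all the entries of `hve` and `Hme` are mutually
independent with law `CN(0,1)`. -/
structure IsRayleighFading {Ω : Type*} [MeasurableSpace Ω] (P : Measure Ω) {Ne Nm : ℕ}
    (hve : Ω → Fin Ne → ℂ) (Hme : Ω → Matrix (Fin Ne) (Fin Nm) ℂ) : Prop where
  hasLaw : ∀ e, HasLaw (channelEntry hve Hme e) stdComplexGaussian P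
  indep : iIndepFun (channelEntry hve Hme) P

/-- The artificial noise precoder: an `Nm × (Nm - 1)` matrix with orthonormal columns in the
null space of the row vector `hvm† Hmm`. -/
structure IsNoisePrecoder {Nm : ℕ} (hvm : Fin Nm → ℂ) (Hmm : Matrix (Fin Nm) (Fin Nm) ℂ)
    (G : Matrix (Fin Nm) (Fin (Nm - 1)) ℂ) : Prop where
  orthonormal : Gᴴ * G = 1
  null : (star hvm ᵥ* Hmm) ᵥ* G = 0

/-- The capacity `C_{v,u} = B₁ log₂ (1 + (P_v / σ_vm²) |h_vm|²)` of the main uplink channel. -/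
def mainCapacity {Nm : ℕ} (B₁ Pv σvm : ℝ) (hvm : Fin Nm → ℂ) : ℝ :=
  B₁ * Real.logb 2 (1 + Pv / σvm ^ 2 * ∑ i, ‖hvm i‖ ^ 2)

/-- The capacity
`C_{e,u} = B₁ log₂ det (I + P_v h_ve h_ve† (σ_ve² I + P_m/(N_m-1) H₁ H₁†)⁻¹)` of the uplink
wiretap channel. The determinant is a real number, at least `1`. -/
def wiretapCapacity {Ne : ℕ} (Nm : ℕ) (B₁ Pv Pm σve : ℝ) (hve : Fin Ne → ℂ)
    (H₁ : Matrix (Fin Ne) (Fin (Nm - 1)) ℂ) : ℝ :=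
  B₁ * Real.logb 2
    (1 + (Pv : ℂ) • (Matrix.vecMulVec hve (star hve) *
      (((σve ^ 2 : ℝ) : ℂ) • (1 : Matrix (Fin Ne) (Fin Ne) ℂ)
        + ((Pm / ((Nm : ℝ) - 1) : ℝ) : ℂ) • (H₁ * H₁ᴴ))⁻¹)).det.re

/-- The instantaneous uplink secrecy rate `R₁ = [C_{v,u} - C_{e,u}]⁺`. -/
def secrecyRate (Cv Ce : ℝ) : ℝ := max (Cv - Ce) 0

/-- The secrecy outage probability `P(R₁ ≤ R_u)`; the main channel, hence its capacity `Cv`, is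
known, and `Ce` is the random capacity of the wiretap channel. -/
def outageProb {Ω : Type*} [MeasurableSpace Ω] (P : Measure Ω) (Cv : ℝ) (Ce : Ω → ℝ)
    (Ru : ℝ) : ℝ :=
  P.real {ω | secrecyRate Cv (Ce ω) ≤ Ru}

/-- The effective secrecy rate `(1 - P_out(R_u)) R_u`. -/
def effectiveSecrecyRate {Ω : Type*} [MeasurableSpace Ω] (P : Measure Ω) (Cv : ℝ) (Ce : Ω → ℝ)
    (Ru : ℝ) : ℝ :=
  (1 - outageProb P Cv Ce Ru) * Ru

/-- `a₁ = σ_ve² (N_m - 1) / P_m`. -/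
def a₁ (Nm : ℕ) (Pm σve : ℝ) : ℝ := σve ^ 2 * ((Nm : ℝ) - 1) / Pm

/-- `φ₁ = P_m / (P_v (N_m - 1)) * (2 ^ ((C_{v,u} - R_u) / B₁) - 1)`. -/
def φ₁ (Nm : ℕ) (B₁ Pv Pm Cv Ru : ℝ) : ℝ :=
  Pm / (Pv * ((Nm : ℝ) - 1)) * ((2 : ℝ) ^ ((Cv - Ru) / B₁) - 1)

/-- The quadratic form `h† (a I + H H†)⁻¹ h`, which is real for real `a`. -/
def quadForm {m n : ℕ} (a : ℝ) (h : Fin m → ℂ) (H : Matrix (Fin m) (Fin n) ℂ) : ℝ :=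
  (star h ⬝ᵥ (((a : ℂ) • (1 : Matrix (Fin m) (Fin m) ℂ) + H * Hᴴ)⁻¹ *ᵥ h)).re

/-- `A_k(z) = (∑_{n=0}^{N_e-k-1} binom(N_m-1, n) z^n) / (1+z)^(N_m-1)`, for `k < N_e`. -/
def coeffA (Ne Nm k : ℕ) (z : ℝ) : ℝ :=
  (∑ n ∈ Finset.range (Ne - k), ((Nm - 1).choose n : ℝ) * z ^ n) / (1 + z) ^ (Nm - 1)

/-- `F(z) = exp(-a z) ∑_{k=0}^{N_e-1} A_k(z) / k! * (a z)^k`. -/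
def F (Ne Nm : ℕ) (a z : ℝ) : ℝ :=
  Real.exp (-(a * z)) *
    ∑ k ∈ Finset.range Ne, coeffA Ne Nm k z / (Nat.factorial k : ℝ) * (a * z) ^ k

end

end UplinkSecrecy

namespace UplinkSecrecy

noncomputable section

/-! ### Product measures with densities -/

/-! Write `m + 1` for the length of the Gaussian vector `h`, `N` for the number of columns of `H`,
and `M = a I + H H†`. Orthonormality of the columns of `G` makes `Hme * G` again a matrix of
independent `CN(0,1)` entries, so everything reduces to the law of `h† M⁻¹ h`.

For fixed `H`, the substitution `h = M^(1/2) u` turns the quadratic form into `|u|²` and the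
Gaussian density into a multiple of `det M * exp(-a|u|²) * exp(-|H†u|²)`
(`lintegral_quadForm_gaussianVec`). After exchanging the integrals, `H` has to be averaged for fixed
`u`. By unitary invariance only `t = |u|²` matters, and `|H†u|²` may be replaced by `t` times the
squared norm of one row of `H`. Expanding `det M` along that row (`gramDet_cons`) and absorbing the
exponential into a rescaling of the row expresses the average through mean Gram determinants
(`lintegral_gramDet_mul_exp_of_mean`). At `t = 0` the same formula is a recursion for these means,
solved by `m!` times the coefficients of `(1 + z)^N exp(a z)`.

Polar coordinates then give a density for the quadratic form. It is minus the derivative of `F`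
(`hasDerivAt_F`), because `F` is a Taylor polynomial of `(1 + z)^N exp(a z)` divided by that
function. The constant in the polar formula is never computed: total mass one and `F 0 = 1` fix it.
Finally the wiretap determinant is a rank-one perturbation of the identity, so the capacity is an
increasing function of `Z₁` and the outage event is a tail event of `Z₁`. -/

lemma lintegral_pi_prod {α : Type*} [MeasurableSpace α] (μ : Measure α) [SigmaFinite μ] {n : ℕ}
    (f : Fin n → α → ENNReal) (hf : ∀ i, Measurable (f i)) :
    ∫⁻ x, ∏ i, f i (x i) ∂Measure.pi (fun _ : Fin n => μ) = ∏ i, ∫⁻ x, f i x ∂μ := by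
  induction n with
  | zero => simp
  | succ n ih =>
    have hmp := (measurePreserving_piFinSuccAbove (fun _ : Fin (n + 1) => μ) 0)
    have hm : Measurable fun p : α × (Fin n → α) => f 0 p.1 * ∏ i : Fin n, f i.succ (p.2 i) := by
      refine ((hf 0).comp measurable_fst).mul (Finset.measurable_prod _ fun i _ => ?_)
      exact (hf i.succ).comp ((measurable_pi_apply i).comp measurable_snd)
    have h1 := hmp.lintegral_comp hm
    have h2 : ∀ x : Fin (n + 1) → α, ∏ i, f i (x i) =
        f 0 (MeasurableEquiv.piFinSuccAbove (fun _ => α) 0 x).1 *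
          ∏ i : Fin n, f i.succ ((MeasurableEquiv.piFinSuccAbove (fun _ => α) 0 x).2 i) := by
      intro x
      rw [Fin.prod_univ_succ]
      rfl
    simp_rw [h2]
    rw [h1, lintegral_prod_mul (f := f 0) (g := fun y : Fin n → α => ∏ i, f i.succ (y i))
      (hf 0).aemeasurable, ih _ fun i => hf i.succ, Fin.prod_univ_succ]
    exact (Finset.measurable_prod _ fun i _ =>
      (hf i.succ).comp (measurable_pi_apply i)).aemeasurable

lemma pi_withDensity {α : Type*} [MeasurableSpace α] (μ : Measure α) [SigmaFinite μ] (n : ℕ)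
    {f : α → ENNReal} (hf : Measurable f) [SigmaFinite (μ.withDensity f)] :
    Measure.pi (fun _ : Fin n => μ.withDensity f) =
      (Measure.pi (fun _ : Fin n => μ)).withDensity (fun x => ∏ i, f (x i)) := by
  refine Measure.pi_eq fun s hs => ?_
  rw [withDensity_apply _ (MeasurableSet.univ_pi hs),
    ← lintegral_indicator (MeasurableSet.univ_pi hs)]
  have : ∀ x : Fin n → α, (Set.univ.pi s).indicator (fun x => ∏ i, f (x i)) x =
      ∏ i, (s i).indicator f (x i) := by
    intro x
    by_cases hx : x ∈ Set.univ.pi s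
    · rw [Set.indicator_of_mem hx]
      exact Finset.prod_congr rfl fun i _ => by rw [Set.indicator_of_mem (hx i trivial)]
    · rw [Set.indicator_of_notMem hx]
      simp only [Set.mem_univ_pi, not_forall] at hx
      obtain ⟨i, hi⟩ := hx
      exact (Finset.prod_eq_zero (Finset.mem_univ i) (Set.indicator_of_notMem hi f)).symm
  simp_rw [this]
  rw [lintegral_pi_prod μ _ fun i => hf.indicator (hs i)]
  exact Finset.prod_congr rfl fun i _ => by
    rw [lintegral_indicator (hs i), withDensity_apply _ (hs i)]

/-- The pushforward can differ from the measure only by the constant factor `|det L|⁻¹`, and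
comparing total masses forces that factor to be 1. No determinant has to be evaluated in the
applications. -/
lemma measurePreserving_withDensity_of_invariant {E : Type*} [NormedAddCommGroup E]
    [NormedSpace ℝ E] [MeasurableSpace E] [BorelSpace E] [FiniteDimensional ℝ E] (μ : Measure E)
    [μ.IsAddHaarMeasure] {g : E → ENNReal} (hg : Measurable g)
    [IsProbabilityMeasure (μ.withDensity g)] (L : E →ₗ[ℝ] E) (hL : Function.Injective L)
    (hgL : ∀ x, g (L x) = g x) :
    MeasurePreserving L (μ.withDensity g) (μ.withDensity g) := by
  have hLm : Measurable L := L.continuous_of_finiteDimensional.measurable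
  have hdet : LinearMap.det L ≠ 0 := by
    have := (LinearEquiv.ofInjectiveEndo L hL).isUnit_det'
    exact this.ne_zero
  set c := ENNReal.ofReal |(LinearMap.det L)⁻¹|
  have h1 : (μ.withDensity g).map L = c • μ.withDensity g := by
    ext s hs
    rw [Measure.map_apply hLm hs, withDensity_apply _ (hLm hs), Measure.smul_apply,
      withDensity_apply _ hs, ← lintegral_smul_measure,
      ← Measure.restrict_smul, ← Measure.map_linearMap_addHaar_eq_smul_addHaar μ hdet,
      setLIntegral_map hs hg hLm]
    simp_rw [hgL]
  have h2 : c = 1 := by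
    have h3 := congrArg (fun ν : Measure E => ν Set.univ) h1
    simp only [Measure.map_apply hLm MeasurableSet.univ, Set.preimage_univ, measure_univ,
      Measure.smul_apply, smul_eq_mul, mul_one] at h3
    exact h3.symm
  exact ⟨hLm, by rw [h1, h2, one_smul]⟩

/-! ### Complex Gaussian vectors and matrices -/

/-- The squared Euclidean norm of a complex vector. -/
def sqNorm {n : ℕ} (x : Fin n → ℂ) : ℝ := ∑ i, ‖x i‖ ^ 2

lemma sqNorm_nonneg {n : ℕ} (x : Fin n → ℂ) : 0 ≤ sqNorm x :=
  Finset.sum_nonneg fun _ _ => by positivity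

lemma continuous_sqNorm {n : ℕ} : Continuous (sqNorm : (Fin n → ℂ) → ℝ) := by
  unfold sqNorm
  fun_prop

lemma sqNorm_eq_zero {n : ℕ} {x : Fin n → ℂ} : sqNorm x = 0 ↔ x = 0 := by
  rw [sqNorm, Finset.sum_eq_zero_iff_of_nonneg fun _ _ => by positivity]
  simp [funext_iff]

lemma sqNorm_eq_dotProduct {n : ℕ} (x : Fin n → ℂ) : ((sqNorm x : ℝ) : ℂ) = star x ⬝ᵥ x := by
  simp [sqNorm, dotProduct, Complex.conj_mul']

lemma stdComplexGaussian_eq_withDensity :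
    stdComplexGaussian =
      (volume : Measure ℂ).withDensity
        (fun z => ENNReal.ofReal (Real.pi⁻¹ * Real.exp (-‖z‖ ^ 2))) := by
  have hv : (1 / 2 : ℝ≥0) ≠ 0 := by norm_num
  have hg : Measurable fun z : ℂ => ENNReal.ofReal (Real.pi⁻¹ * Real.exp (-‖z‖ ^ 2)) := by
    fun_prop
  have hfun : (fun p : ℝ × ℝ => (p.1 : ℂ) + (p.2 : ℂ) * Complex.I) =
      Complex.measurableEquivRealProd.symm := by
    funext p
    apply Complex.ext <;> simp
  rw [stdComplexGaussian, gaussianReal_of_var_ne_zero _ hv,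
    prod_withDensity (measurable_gaussianPDF _ _) (measurable_gaussianPDF _ _), hfun]
  have hmp := Complex.volume_preserving_equiv_real_prod.symm
  ext s hs
  rw [Measure.map_apply hmp.measurable hs, withDensity_apply _ (hmp.measurable hs),
    withDensity_apply _ hs, ← hmp.map_eq, setLIntegral_map hs hg hmp.measurable]
  refine setLIntegral_congr_fun (hmp.measurable hs) fun p _ => ?_
  simp only [gaussianPDF]
  rw [← ENNReal.ofReal_mul (gaussianPDFReal_nonneg _ _ _)]
  congr 1
  have hn : ‖Complex.measurableEquivRealProd.symm p‖ ^ 2 = p.1 ^ 2 + p.2 ^ 2 := by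
    rw [← Complex.normSq_eq_norm_sq, Complex.normSq_apply]
    simp
    ring
  rw [hn]
  simp only [gaussianPDFReal, sub_zero]
  have hs : √(2 * Real.pi * ((1 / 2 : ℝ≥0) : ℝ)) ^ 2 = Real.pi := by
    rw [Real.sq_sqrt (by positivity)]
    simp
    ring
  have h2 : (2 * ((1 / 2 : ℝ≥0) : ℝ)) = 1 := by simp
  rw [h2, mul_mul_mul_comm, ← Real.exp_add, ← mul_inv, ← sq, hs]
  congr 2
  ring

instance : IsProbabilityMeasure stdComplexGaussian := by
  unfold stdComplexGaussian
  exact Measure.isProbabilityMeasure_map (by fun_prop)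

/-- The law of a vector of `n` independent `CN(0,1)` variables. -/
abbrev gaussianVec (n : ℕ) : Measure (Fin n → ℂ) := Measure.pi fun _ => stdComplexGaussian

/-- The law of an `m × n` matrix of independent `CN(0,1)` variables, by rows. -/
abbrev gaussianMat (m n : ℕ) : Measure (Fin m → Fin n → ℂ) := Measure.pi fun _ => gaussianVec n

lemma gaussianVec_eq_withDensity (n : ℕ) :
    gaussianVec n = (volume : Measure (Fin n → ℂ)).withDensity
      (fun x => ENNReal.ofReal ((Real.pi⁻¹) ^ n * Real.exp (-sqNorm x))) := by
  have h := stdComplexGaussian_eq_withDensity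
  have : SigmaFinite ((volume : Measure ℂ).withDensity
      fun z => ENNReal.ofReal (Real.pi⁻¹ * Real.exp (-‖z‖ ^ 2))) := by
    rw [← h]; infer_instance
  rw [gaussianVec, h, pi_withDensity _ n (by fun_prop)]
  congr 1
  funext x
  rw [← ENNReal.ofReal_prod_of_nonneg fun _ _ => by positivity, Finset.prod_mul_distrib,
    ← Real.exp_sum]
  simp [sqNorm]

lemma gaussianMat_eq_withDensity (m n : ℕ) :
    gaussianMat m n = (volume : Measure (Fin m → Fin n → ℂ)).withDensity
      (fun x => ENNReal.ofReal (((Real.pi⁻¹) ^ n) ^ m * Real.exp (-∑ i, sqNorm (x i)))) := by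
  have h := gaussianVec_eq_withDensity n
  have : SigmaFinite ((volume : Measure (Fin n → ℂ)).withDensity
      fun x => ENNReal.ofReal ((Real.pi⁻¹) ^ n * Real.exp (-sqNorm x))) := by
    rw [← h]; infer_instance
  have hc := continuous_sqNorm (n := n)
  rw [gaussianMat, h, pi_withDensity _ m (by fun_prop)]
  congr 1
  funext x
  rw [← ENNReal.ofReal_prod_of_nonneg fun _ _ => by positivity, Finset.prod_mul_distrib,
    ← Real.exp_sum]
  simp

lemma measurePreserving_gaussianVec {n : ℕ} (L : (Fin n → ℂ) →ₗ[ℝ] (Fin n → ℂ))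
    (hL : ∀ x, sqNorm (L x) = sqNorm x) :
    MeasurePreserving L (gaussianVec n) (gaussianVec n) := by
  have h := gaussianVec_eq_withDensity n
  have hp : IsProbabilityMeasure (gaussianVec n) := inferInstance
  have hc := continuous_sqNorm (n := n)
  rw [h] at hp ⊢
  refine measurePreserving_withDensity_of_invariant volume (by fun_prop) L ?_ fun x => by rw [hL]
  rw [← LinearMap.ker_eq_bot, LinearMap.ker_eq_bot']
  intro x hx
  rw [← sqNorm_eq_zero, ← hL, hx, sqNorm_eq_zero]

lemma measurePreserving_gaussianMat {m n : ℕ}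
    (L : (Fin m → Fin n → ℂ) →ₗ[ℝ] (Fin m → Fin n → ℂ))
    (hL : ∀ x, ∑ i, sqNorm (L x i) = ∑ i, sqNorm (x i)) :
    MeasurePreserving L (gaussianMat m n) (gaussianMat m n) := by
  have h := gaussianMat_eq_withDensity m n
  have hp : IsProbabilityMeasure (gaussianMat m n) := inferInstance
  have hc := continuous_sqNorm (n := n)
  have hH : (volume : Measure (Fin m → Fin n → ℂ)).IsAddHaarMeasure :=
    Measure.pi.isAddHaarMeasure _
  rw [h] at hp ⊢
  refine measurePreserving_withDensity_of_invariant volume (by fun_prop) L ?_ fun x => by rw [hL]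
  have h0 : ∀ x : Fin m → Fin n → ℂ, ∑ i, sqNorm (x i) = 0 ↔ x = 0 := fun x => by
    rw [Finset.sum_eq_zero_iff_of_nonneg fun _ _ => sqNorm_nonneg _]
    simp [funext_iff, sqNorm_eq_zero]
  rw [← LinearMap.ker_eq_bot, LinearMap.ker_eq_bot']
  intro x hx
  rw [← h0, ← hL, hx, h0]

open scoped ComplexOrder

/-! ### Unitary invariance -/

/-- Extends an orthonormal family to an orthonormal basis. The map `e` chooses which columns are
prescribed: all but the last for a precoder, column 0 for aligning a vector. -/
lemma exists_unitary_extension {n k : ℕ} (G : Matrix (Fin n) (Fin k) ℂ) (hG : Gᴴ * G = 1)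
    (e : Fin k → Fin n) (he : Function.Injective e) :
    ∃ W : Matrix (Fin n) (Fin n) ℂ, Wᴴ * W = 1 ∧ ∀ i j, W i (e j) = G i j := by
  classical
  let v : Fin n → EuclideanSpace ℂ (Fin n) := fun c =>
    WithLp.toLp 2 fun i => if h : ∃ j, e j = c then G i h.choose else 0
  have hv : ∀ j, v (e j) = WithLp.toLp 2 fun i => G i j := fun j => by
    have h : ∃ j', e j' = e j := ⟨j, rfl⟩
    have hc : h.choose = j := he h.choose_spec
    simp only [v, dif_pos h, hc]
  have hGij : ∀ i j, ∑ l, star (G l i) * G l j = if i = j then 1 else 0 := fun i j => by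
    have := congrFun (congrFun hG i) j
    simpa [Matrix.mul_apply, Matrix.one_apply] using this
  have hort : Orthonormal ℂ ((Set.range e).domRestrict v) := by
    rw [orthonormal_iff_ite]
    rintro ⟨_, i, rfl⟩ ⟨_, j, rfl⟩
    simp only [Set.domRestrict_apply, hv]
    rw [PiLp.inner_apply]
    have hij : ((⟨e i, Set.mem_range_self i⟩ : Set.range e) = ⟨e j, Set.mem_range_self j⟩) ↔
        i = j := by
      rw [Subtype.mk.injEq, he.eq_iff]
    simp only [hij]
    rw [← hGij i j]
    exact Finset.sum_congr rfl fun l _ => by simp [mul_comm]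
  obtain ⟨b, hb⟩ := hort.exists_orthonormalBasis_extension_of_card_eq (by simp)
  refine ⟨Matrix.of fun i c => b c i, ?_, fun i j => ?_⟩
  · ext c d
    have := orthonormal_iff_ite.mp b.orthonormal c d
    rw [PiLp.inner_apply] at this
    rw [Matrix.mul_apply, Matrix.one_apply, ← this]
    exact Finset.sum_congr rfl fun l _ => by simp [mul_comm]
  · change b (e j) i = _
    rw [hb _ ⟨j, rfl⟩, hv]

lemma sqNorm_mulVec {n k : ℕ} (G : Matrix (Fin n) (Fin k) ℂ) (hG : Gᴴ * G = 1)
    (x : Fin k → ℂ) : sqNorm (G *ᵥ x) = sqNorm x := by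
  have : ((sqNorm (G *ᵥ x) : ℝ) : ℂ) = ((sqNorm x : ℝ) : ℂ) := by
    rw [sqNorm_eq_dotProduct, sqNorm_eq_dotProduct, Matrix.star_mulVec,
      ← Matrix.dotProduct_mulVec, Matrix.mulVec_mulVec, hG, Matrix.one_mulVec]
  exact_mod_cast this

lemma sqNorm_vecMul {n : ℕ} (W : Matrix (Fin n) (Fin n) ℂ) (hW : Wᴴ * W = 1)
    (x : Fin n → ℂ) : sqNorm (x ᵥ* W) = sqNorm x := by
  rw [← Matrix.mulVec_transpose]
  refine sqNorm_mulVec _ ?_ x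
  change (Wᴴ)ᵀ * Wᵀ = 1
  rw [← Matrix.transpose_mul, mul_eq_one_comm.mp hW,
    Matrix.transpose_one]

/-- Multiplication by a matrix with orthonormal columns maps a row of independent `CN(0,1)`
variables to a row of independent `CN(0,1)` variables. -/
lemma measurePreserving_vecMul {n : ℕ} (G : Matrix (Fin (n + 1)) (Fin n) ℂ) (hG : Gᴴ * G = 1) :
    MeasurePreserving (fun r : Fin (n + 1) → ℂ => r ᵥ* G) (gaussianVec (n + 1))
      (gaussianVec n) := by
  obtain ⟨W, hW, hWG⟩ := exists_unitary_extension G hG Fin.castSucc (Fin.castSucc_injective n)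
  have h1 : MeasurePreserving (W.vecMulLinear.restrictScalars ℝ) (gaussianVec (n + 1))
      (gaussianVec (n + 1)) := by
    refine measurePreserving_gaussianVec _ fun x => ?_
    exact sqNorm_vecMul W hW x
  -- Multiplying by `G` is multiplying by its unitary extension and then dropping the last
  -- coordinate, which is a marginal of the product measure.
  have h2 := measurePreserving_snd.comp
    ((measurePreserving_piFinSuccAbove (fun _ : Fin (n + 1) => stdComplexGaussian)
      (Fin.last n)).comp h1)
  convert h2 using 1
  funext r
  funext j
  simp only [Function.comp_apply]
  change _ = (r ᵥ* W) ((Fin.last n).succAbove j)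
  rw [Fin.succAbove_last]
  simp [Matrix.vecMul, dotProduct, hWG]

lemma measurePreserving_unitary_mul {m n : ℕ} (U : Matrix (Fin m) (Fin m) ℂ) (hU : Uᴴ * U = 1) :
    MeasurePreserving (fun H : Fin m → Fin n → ℂ => Matrix.of.symm (U * Matrix.of H))
      (gaussianMat m n) (gaussianMat m n) := by
  let L : (Fin m → Fin n → ℂ) →ₗ[ℝ] (Fin m → Fin n → ℂ) :=
    { toFun := fun H => Matrix.of.symm (U * Matrix.of H)
      map_add' := fun A B => Matrix.mul_add U (Matrix.of A) (Matrix.of B)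
      map_smul' := fun c A => Matrix.mul_smul U c (Matrix.of A) }
  refine measurePreserving_gaussianMat L fun H => ?_
  -- The Frobenius norm is summed by columns, since `U` acts on each column separately.
  have h : ∀ A : Fin m → Fin n → ℂ, ∑ i, sqNorm (A i) = ∑ j, sqNorm fun i => A i j := fun A => by
    simp only [sqNorm]
    exact Finset.sum_comm
  rw [h, h]
  exact Finset.sum_congr rfl fun j _ => sqNorm_mulVec U hU fun i => H i j

/-- The first column of `U` is `u / |u|`; any unitary works when `u = 0`. -/
lemma exists_unitary_align {m : ℕ} (u : Fin (m + 1) → ℂ) :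
    ∃ U : Matrix (Fin (m + 1)) (Fin (m + 1)) ℂ, Uᴴ * U = 1 ∧
      Uᴴ *ᵥ u = Pi.single 0 ((√(sqNorm u) : ℝ) : ℂ) := by
  by_cases hu : u = 0
  · exact ⟨1, by simp, by simp [hu, sqNorm]⟩
  have hpos : 0 < sqNorm u :=
    lt_of_le_of_ne (sqNorm_nonneg u) fun h => hu (sqNorm_eq_zero.mp h.symm)
  have hs0 : ((√(sqNorm u) : ℝ) : ℂ) ≠ 0 := by
    exact_mod_cast (Real.sqrt_pos.mpr hpos).ne'
  set s : ℂ := ((√(sqNorm u) : ℝ) : ℂ) with hs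
  have hss : s * s = star u ⬝ᵥ u := by
    rw [← sqNorm_eq_dotProduct, hs]
    exact_mod_cast Real.mul_self_sqrt hpos.le
  have hstar : star s = s := by simp [hs]
  let G : Matrix (Fin (m + 1)) (Fin 1) ℂ := Matrix.of fun i _ => s⁻¹ * u i
  have hG : Gᴴ * G = 1 := by
    ext i j
    have hsum : ∑ x, star (u x) * u x = s * s := hss.symm
    have : (Gᴴ * G) i j = s⁻¹ * s⁻¹ * ∑ x, star (u x) * u x := by
      rw [Matrix.mul_apply, Finset.mul_sum]
      refine Finset.sum_congr rfl fun x _ => ?_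
      simp only [Matrix.conjTranspose_apply, Matrix.of_apply, G, star_mul', star_inv₀, hstar]
      ring
    rw [this, hsum, Subsingleton.elim i j, Matrix.one_apply_eq]
    field_simp
  obtain ⟨U, hU, hUG⟩ := exists_unitary_extension G hG (fun _ => 0)
    (fun i j _ => Subsingleton.elim i j)
  refine ⟨U, hU, ?_⟩
  have : u = U *ᵥ Pi.single 0 s := by
    funext i
    rw [Matrix.mulVec_single]
    simp only [MulOpposite.smul_eq_mul_unop, MulOpposite.unop_op, Matrix.col_apply,
      Pi.smul_apply]
    rw [hUG i 0]
    simp only [G, Matrix.of_apply]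
    field_simp
  conv_lhs => rw [this]
  rw [Matrix.mulVec_mulVec, hU, Matrix.one_mulVec]

lemma measurePreserving_removeRow {m n : ℕ} (i : Fin (m + 1)) :
    MeasurePreserving (fun H : Fin (m + 1) → Fin n → ℂ => fun j => H (i.succAbove j))
      (gaussianMat (m + 1) n) (gaussianMat m n) :=
  measurePreserving_snd.comp
    (measurePreserving_piFinSuccAbove (fun _ : Fin (m + 1) => gaussianVec n) i)

/-! ### The Gram matrix -/

/-- The matrix `a I + H H†`. -/
def gram {m n : ℕ} (a : ℝ) (H : Matrix (Fin m) (Fin n) ℂ) : Matrix (Fin m) (Fin m) ℂ :=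
  (a : ℂ) • (1 : Matrix (Fin m) (Fin m) ℂ) + H * Hᴴ

lemma gram_posDef {m n : ℕ} {a : ℝ} (ha : 0 < a) (H : Matrix (Fin m) (Fin n) ℂ) :
    (gram a H).PosDef := by
  refine Matrix.PosDef.add_posSemidef ?_ (Matrix.posSemidef_self_mul_conjTranspose H)
  refine Matrix.PosDef.one.smul ?_
  exact_mod_cast ha

/-- The determinant of `a I + H H†`, as a real number. -/
def gramDet {m n : ℕ} (a : ℝ) (H : Matrix (Fin m) (Fin n) ℂ) : ℝ := (gram a H).det.re

lemma ofReal_gramDet {m n : ℕ} {a : ℝ} (ha : 0 < a) (H : Matrix (Fin m) (Fin n) ℂ) :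
    ((gramDet a H : ℝ) : ℂ) = (gram a H).det := by
  have := (gram_posDef ha H).det_pos
  rw [Complex.lt_def] at this
  apply Complex.ext <;> simp [gramDet, ← this.2]

lemma gramDet_pos {m n : ℕ} {a : ℝ} (ha : 0 < a) (H : Matrix (Fin m) (Fin n) ℂ) :
    0 < gramDet a H := by
  have := (gram_posDef ha H).det_pos
  rw [Complex.lt_def] at this
  exact this.1

lemma continuous_gram {m n : ℕ} (a : ℝ) :
    Continuous fun H : Fin m → Fin n → ℂ => gram a (Matrix.of H) := by
  unfold gram
  have h : Continuous fun H : Fin m → Fin n → ℂ => (Matrix.of H : Matrix (Fin m) (Fin n) ℂ) :=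
    continuous_id
  exact continuous_const.add (h.matrix_mul h.matrix_conjTranspose)

lemma continuous_gramDet {m n : ℕ} (a : ℝ) :
    Continuous fun H : Fin m → Fin n → ℂ => gramDet a (Matrix.of H) :=
  Complex.continuous_re.comp (continuous_gram a).matrix_det

lemma sqNorm_conjTranspose_mulVec_add {m n : ℕ} (a : ℝ) (H : Matrix (Fin m) (Fin n) ℂ)
    (u : Fin m → ℂ) :
    ((a * sqNorm u + sqNorm (Hᴴ *ᵥ u) : ℝ) : ℂ) = star u ⬝ᵥ gram a H *ᵥ u := by
  rw [gram, Matrix.add_mulVec, dotProduct_add, Matrix.smul_mulVec, Matrix.one_mulVec,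
    dotProduct_smul, ← Matrix.mulVec_mulVec, Matrix.dotProduct_mulVec _ H]
  push_cast
  rw [sqNorm_eq_dotProduct, sqNorm_eq_dotProduct, Matrix.star_mulVec,
    Matrix.conjTranspose_conjTranspose, smul_eq_mul]

open scoped MatrixOrder in
lemma exists_hermitian_sqrt {m : ℕ} {M : Matrix (Fin m) (Fin m) ℂ} (hM : M.PosDef) :
    ∃ S : Matrix (Fin m) (Fin m) ℂ, Sᴴ = S ∧ S * S = M :=
  ⟨CFC.sqrt M, (CFC.sqrt_nonneg M).isSelfAdjoint,
    CFC.sqrt_mul_sqrt_self M hM.posSemidef.nonneg⟩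

lemma continuous_quadForm {m n : ℕ} {a : ℝ} (ha : 0 < a) :
    Continuous fun p : (Fin m → ℂ) × (Fin m → Fin n → ℂ) =>
      quadForm a p.1 (Matrix.of p.2) := by
  have hg : Continuous fun p : (Fin m → ℂ) × (Fin m → Fin n → ℂ) => gram a (Matrix.of p.2) :=
    (continuous_gram a).comp continuous_snd
  have hinv : Continuous fun p : (Fin m → ℂ) × (Fin m → Fin n → ℂ) =>
      (gram a (Matrix.of p.2))⁻¹ := by
    have : ∀ p : (Fin m → ℂ) × (Fin m → Fin n → ℂ), (gram a (Matrix.of p.2))⁻¹ =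
        (gram a (Matrix.of p.2)).det⁻¹ • (gram a (Matrix.of p.2)).adjugate := fun p => by
      rw [Matrix.inv_def, Ring.inverse_eq_inv']
    simp_rw [this]
    exact (hg.matrix_det.inv₀ fun p => (gram_posDef ha _).det_pos.ne').smul hg.matrix_adjugate
  exact Complex.continuous_re.comp
    ((continuous_star.comp continuous_fst).dotProduct (hinv.matrix_mulVec continuous_fst))

/-- The law of `h† (a I + H H†)⁻¹ h` for a fixed matrix `H` and a Gaussian vector `h`. -/
lemma lintegral_quadForm_gaussianVec {m n : ℕ} {a : ℝ} (ha : 0 < a)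
    (H : Matrix (Fin m) (Fin n) ℂ) {f : ℝ → ENNReal} (hf : Measurable f) :
    ∫⁻ h, f (quadForm a h H) ∂gaussianVec m =
      ∫⁻ u : Fin m → ℂ, f (sqNorm u) * ENNReal.ofReal ((Real.pi⁻¹) ^ m * Real.exp (-(a * sqNorm u)) *
        (gramDet a H * Real.exp (-sqNorm (Hᴴ *ᵥ u)))) := by
  have hM := gram_posDef ha H
  obtain ⟨S, hSH, hSS⟩ := exists_hermitian_sqrt hM
  have hMdet : IsUnit (gram a H).det := hM.det_pos.ne'.isUnit
  let L : (Fin m → ℂ) →ₗ[ℝ] (Fin m → ℂ) := (Matrix.toLin' S).restrictScalars ℝ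
  have hLapp : ∀ u, L u = S *ᵥ u := fun u => rfl
  -- The real Jacobian of a complex linear map is `|det S|²`, which equals `det M` because `S` is
  -- Hermitian with `S * S = M`.
  have hdet : LinearMap.det L = gramDet a H := by
    rw [LinearMap.det_restrictScalars, LinearMap.det_toLin', Algebra.norm_complex_apply,
      Complex.normSq_eq_norm_sq, ← Complex.ofReal_inj, ofReal_gramDet ha, ← hSS, Matrix.det_mul]
    push_cast
    rw [← Complex.conj_mul']
    rw [starRingEnd_apply, ← Matrix.det_conjTranspose, hSH]
  have hdpos := gramDet_pos ha H
  have hmap := Measure.map_linearMap_addHaar_eq_smul_addHaar (volume : Measure (Fin m → ℂ))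
    (f := L) (by rw [hdet]; exact hdpos.ne')
  have hvol : (volume : Measure (Fin m → ℂ)) = ENNReal.ofReal (gramDet a H) • volume.map L := by
    rw [hmap, smul_smul, hdet, ← ENNReal.ofReal_mul hdpos.le, abs_of_pos (inv_pos.mpr hdpos),
      mul_inv_cancel₀ hdpos.ne', ENNReal.ofReal_one, one_smul]
  have hqm : Measurable fun h : Fin m → ℂ => quadForm a h H :=
    ((continuous_quadForm (n := n) ha).comp (continuous_id.prodMk continuous_const)).measurable
  have hc := continuous_sqNorm (n := m)
  have hZ : ∀ u, quadForm a (S *ᵥ u) H = sqNorm u := by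
    intro u
    have : star (S *ᵥ u) ⬝ᵥ ((gram a H)⁻¹ *ᵥ (S *ᵥ u)) = ((sqNorm u : ℝ) : ℂ) := by
      have hSu : IsUnit S.det := by
        rw [← hSS, Matrix.det_mul] at hMdet
        exact isUnit_of_mul_isUnit_left hMdet
      rw [Matrix.star_mulVec, hSH, ← Matrix.dotProduct_mulVec, Matrix.mulVec_mulVec,
        Matrix.mulVec_mulVec, ← hSS, Matrix.mul_inv_rev, ← Matrix.mul_assoc,
        Matrix.mul_nonsing_inv _ hSu, Matrix.one_mul, Matrix.nonsing_inv_mul _ hSu, Matrix.one_mulVec, sqNorm_eq_dotProduct]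
    exact (congrArg Complex.re this).trans (Complex.ofReal_re _)
  have hN : ∀ u, sqNorm (S *ᵥ u) = a * sqNorm u + sqNorm (Hᴴ *ᵥ u) := by
    intro u
    rw [← Complex.ofReal_inj, sqNorm_conjTranspose_mulVec_add, sqNorm_eq_dotProduct,
      Matrix.star_mulVec, hSH, ← Matrix.dotProduct_mulVec, Matrix.mulVec_mulVec, hSS]
  have hfq : Measurable fun h : Fin m → ℂ => f (quadForm a h H) := hf.comp hqm
  rw [gaussianVec_eq_withDensity, lintegral_withDensity_eq_lintegral_mul _ (by fun_prop) hfq]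
  conv_lhs => rw [hvol]
  have hLm : Measurable L := L.continuous_of_finiteDimensional.measurable
  rw [lintegral_smul_measure, lintegral_map (by
    refine Measurable.mul (by fun_prop) hfq) hLm, smul_eq_mul,
    ← lintegral_const_mul' _ _ ENNReal.ofReal_ne_top]
  refine lintegral_congr fun u => ?_
  simp only [Pi.mul_apply, hLapp, hZ, hN]
  rw [← mul_assoc, ← ENNReal.ofReal_mul hdpos.le, mul_comm]
  congr 2
  rw [neg_add, Real.exp_add]
  ring

/-! ### Second moments -/

lemma integrable_norm_sq_stdComplexGaussian :
    Integrable (fun z : ℂ => ‖z‖ ^ 2) stdComplexGaussian ∧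
      ∫ z, ‖z‖ ^ 2 ∂stdComplexGaussian = 1 := by
  have hsq : Integrable (fun x : ℝ => x ^ 2) (gaussianReal 0 (1 / 2 : ℝ≥0)) :=
    (memLp_id_gaussianReal 2).integrable_sq
  have hint : ∫ x, x ^ 2 ∂gaussianReal 0 (1 / 2 : ℝ≥0) = 1 / 2 := by
    have h := variance_fun_id_gaussianReal (μ := 0) (v := (1 / 2 : ℝ≥0))
    rw [variance_eq_integral measurable_id'.aemeasurable] at h
    simpa using h
  have hmeas : Measurable fun p : ℝ × ℝ => (p.1 : ℂ) + (p.2 : ℂ) * Complex.I := by fun_prop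
  have hn : ∀ p : ℝ × ℝ, ‖(p.1 : ℂ) + (p.2 : ℂ) * Complex.I‖ ^ 2 = p.1 ^ 2 + p.2 ^ 2 := fun p => by
    rw [← Complex.normSq_eq_norm_sq, Complex.normSq_apply]
    simp
    ring
  have hm : AEStronglyMeasurable (fun z : ℂ => ‖z‖ ^ 2) (Measure.map (fun p : ℝ × ℝ =>
      (p.1 : ℂ) + (p.2 : ℂ) * Complex.I)
      ((gaussianReal 0 (1 / 2 : ℝ≥0)).prod (gaussianReal 0 (1 / 2 : ℝ≥0)))) := by fun_prop
  have h1 := hsq.comp_fst (gaussianReal 0 (1 / 2 : ℝ≥0))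
  have h2 := hsq.comp_snd (gaussianReal 0 (1 / 2 : ℝ≥0))
  unfold stdComplexGaussian
  constructor
  · rw [integrable_map_measure hm hmeas.aemeasurable]
    simp only [Function.comp_def, hn]
    exact h1.add h2
  · rw [integral_map hmeas.aemeasurable hm]
    simp only [hn]
    rw [integral_add h1 h2, integral_fun_fst (fun x : ℝ => x ^ 2),
      integral_fun_snd (fun x : ℝ => x ^ 2), hint]
    norm_num

lemma integrable_norm_sq_coord {n : ℕ} (i : Fin n) :
    Integrable (fun r : Fin n → ℂ => ‖r i‖ ^ 2) (gaussianVec n) :=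
  (measurePreserving_eval (fun _ : Fin n => stdComplexGaussian) i).integrable_comp_of_integrable
    integrable_norm_sq_stdComplexGaussian.1

lemma integrable_coord_mul_star {n : ℕ} (i j : Fin n) :
    Integrable (fun r : Fin n → ℂ => r i * star (r j)) (gaussianVec n) := by
  refine ((integrable_norm_sq_coord i).add (integrable_norm_sq_coord j)).mono'
    (by fun_prop) (Filter.Eventually.of_forall fun r => ?_)
  simp only [norm_mul, norm_star, Pi.add_apply]
  nlinarith [sq_nonneg (‖r i‖ - ‖r j‖), sq_nonneg (‖r i‖ + ‖r j‖)]

lemma integral_coord_mul_star {n : ℕ} (i j : Fin n) :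
    ∫ r, r i * star (r j) ∂gaussianVec n = if i = j then 1 else 0 := by
  split_ifs with hij
  · subst hij
    have h : ∀ r : Fin n → ℂ, r i * star (r i) = ((‖r i‖ ^ 2 : ℝ) : ℂ) := fun r => by
      push_cast
      exact Complex.mul_conj' _
    simp_rw [h]
    rw [integral_complex_ofReal]
    have hmp := measurePreserving_eval (fun _ : Fin n => stdComplexGaussian) i
    have h2 := integral_map (μ := gaussianVec n) hmp.measurable.aemeasurable
      (f := fun z : ℂ => ‖z‖ ^ 2) (by fun_prop)
    rw [hmp.map_eq] at h2
    rw [show (∫ r : Fin n → ℂ, ‖r i‖ ^ 2 ∂gaussianVec n) = 1 from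
      h2.symm.trans integrable_norm_sq_stdComplexGaussian.2]
    simp
  -- Flipping the sign of coordinate `i` preserves the law and negates the integrand, so the
  -- integral equals its own negative.
  · let L : (Fin n → ℂ) →ₗ[ℝ] (Fin n → ℂ) :=
      LinearMap.pi fun k => (if k = i then (-1 : ℝ) else 1) • LinearMap.proj k
    have hL : MeasurePreserving L (gaussianVec n) (gaussianVec n) := by
      refine measurePreserving_gaussianVec L fun x => ?_
      refine Finset.sum_congr rfl fun k _ => ?_
      simp only [L, LinearMap.pi_apply, LinearMap.smul_apply, LinearMap.proj_apply]
      split_ifs <;> simp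
    have h := integral_map (μ := gaussianVec n) hL.measurable.aemeasurable
      (f := fun r : Fin n → ℂ => r i * star (r j)) (by fun_prop)
    rw [hL.map_eq] at h
    have hLij : ∀ r : Fin n → ℂ, L r i * star (L r j) = -(r i * star (r j)) := fun r => by
      simp [L, Ne.symm hij]
    simp only [hLij, integral_neg] at h
    exact self_eq_neg.mp h

lemma integrable_quadratic {n : ℕ} (K : Matrix (Fin n) (Fin n) ℂ) :
    Integrable (fun r : Fin n → ℂ => r ⬝ᵥ K *ᵥ star r) (gaussianVec n) ∧
      ∫ r, r ⬝ᵥ K *ᵥ star r ∂gaussianVec n = K.trace := by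
  have hexp : ∀ r : Fin n → ℂ, r ⬝ᵥ K *ᵥ star r = ∑ i, ∑ j, K i j * (r i * star (r j)) := by
    intro r
    simp only [dotProduct, Matrix.mulVec, Finset.mul_sum, Pi.star_apply]
    exact Finset.sum_congr rfl fun i _ => Finset.sum_congr rfl fun j _ => by ring
  have hi : ∀ i j, Integrable (fun r : Fin n → ℂ => K i j * (r i * star (r j))) (gaussianVec n) :=
    fun i j => (integrable_coord_mul_star i j).const_mul _
  simp_rw [hexp]
  refine ⟨integrable_finsetSum _ fun i _ => integrable_finsetSum _ fun j _ => hi i j, ?_⟩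
  rw [integral_finsetSum _ fun i _ => integrable_finsetSum _ fun j _ => hi i j, Matrix.trace]
  refine Finset.sum_congr rfl fun i _ => ?_
  rw [integral_finsetSum _ fun j _ => hi i j]
  simp_rw [integral_const_mul, integral_coord_mul_star]
  simp

lemma sqNorm_real_smul {n : ℕ} (s : ℝ) (x : Fin n → ℂ) : sqNorm (s • x) = s ^ 2 * sqNorm x := by
  simp [sqNorm, Finset.mul_sum, mul_pow]

/-- Exponential tilting of a Gaussian vector is a rescaling. -/
lemma lintegral_mul_exp_neg_sqNorm {n : ℕ} {t : ℝ} (ht : 0 ≤ t) {f : (Fin n → ℂ) → ENNReal}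
    (hf : Measurable f) :
    ∫⁻ r, f r * ENNReal.ofReal (Real.exp (-(t * sqNorm r))) ∂gaussianVec n =
      ENNReal.ofReal ((1 + t) ^ n)⁻¹ * ∫⁻ r, f ((√(1 + t))⁻¹ • r) ∂gaussianVec n := by
  have h1t : 0 < 1 + t := by linarith
  set s := √(1 + t) with hs
  have hs0 : 0 < s := Real.sqrt_pos.mpr h1t
  have hss : s ^ 2 = 1 + t := Real.sq_sqrt h1t.le
  have hc := continuous_sqNorm (n := n)
  have hsm : Measurable fun x : Fin n → ℂ => s⁻¹ • x := measurable_const_smul _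
  have hfs : Measurable fun x : Fin n → ℂ => f (s⁻¹ • x) := hf.comp hsm
  have hmap := Measure.map_addHaar_smul (volume : Measure (Fin n → ℂ)) (r := s⁻¹)
    (inv_pos.mpr hs0).ne'
  have hfr : Module.finrank ℝ (Fin n → ℂ) = 2 * n := by
    rw [Module.finrank_pi_fintype]
    simp [Complex.finrank_real_complex, mul_comm]
  -- The real dimension is `2 n`, so the square root in `s` disappears.
  have hconst : |((s⁻¹) ^ Module.finrank ℝ (Fin n → ℂ))⁻¹| = (1 + t) ^ n := by
    rw [hfr, pow_mul, inv_pow, hss, inv_pow, inv_inv, abs_of_pos (pow_pos h1t n)]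
  rw [hconst] at hmap
  rw [gaussianVec_eq_withDensity, lintegral_withDensity_eq_lintegral_mul _ (by fun_prop)
    (by fun_prop), lintegral_withDensity_eq_lintegral_mul _ (by fun_prop) hfs]
  have hF : Measurable fun y : Fin n → ℂ =>
      ENNReal.ofReal ((Real.pi⁻¹) ^ n * Real.exp (-(s ^ 2 * sqNorm y))) * f y := by fun_prop
  have h2 : ∀ x : Fin n → ℂ,
      ENNReal.ofReal ((Real.pi⁻¹) ^ n * Real.exp (-sqNorm x)) * f (s⁻¹ • x) =
        (fun y : Fin n → ℂ => ENNReal.ofReal ((Real.pi⁻¹) ^ n * Real.exp (-(s ^ 2 * sqNorm y))) *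
          f y) (s⁻¹ • x) := by
    intro x
    have : s ^ 2 * ((s⁻¹) ^ 2 * sqNorm x) = sqNorm x := by
      field_simp
    simp only [sqNorm_real_smul, this]
  simp only [Pi.mul_apply, h2]
  rw [← lintegral_map hF hsm, hmap,
    lintegral_smul_measure, smul_eq_mul, ← mul_assoc, ← ENNReal.ofReal_mul (by positivity),
    inv_mul_cancel₀ (pow_pos h1t n).ne', ENNReal.ofReal_one, one_mul]
  refine lintegral_congr fun r => ?_
  rw [mul_left_comm, ← ENNReal.ofReal_mul (by positivity), mul_comm (f r), hss]
  congr 2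
  rw [mul_assoc, ← Real.exp_add]
  ring_nf

lemma lintegral_one_add_quadratic_mul_exp {n : ℕ} {t : ℝ} (ht : 0 ≤ t)
    {K : Matrix (Fin n) (Fin n) ℂ} (hK : K.PosSemidef) :
    ∫⁻ r, ENNReal.ofReal ((1 + (r ⬝ᵥ K *ᵥ star r).re) * Real.exp (-(t * sqNorm r)))
        ∂gaussianVec n =
      ENNReal.ofReal (((1 + t) ^ n)⁻¹ * (1 + K.trace.re / (1 + t))) := by
  have h1t : 0 < 1 + t := by linarith
  have hnn : ∀ r : Fin n → ℂ, 0 ≤ (r ⬝ᵥ K *ᵥ star r).re := fun r => by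
    have := hK.dotProduct_mulVec_nonneg (star r)
    rw [star_star] at this
    exact (Complex.le_def.mp this).1
  have hcq : Continuous fun r : Fin n → ℂ => (r ⬝ᵥ K *ᵥ star r).re :=
    Complex.continuous_re.comp
      (continuous_id.dotProduct (continuous_const.matrix_mulVec continuous_star))
  have hmeas : Measurable fun r : Fin n → ℂ => ENNReal.ofReal (1 + (r ⬝ᵥ K *ᵥ star r).re) := by
    fun_prop
  simp_rw [fun r : Fin n → ℂ => ENNReal.ofReal_mul (q := Real.exp (-(t * sqNorm r)))
    (add_nonneg zero_le_one (hnn r))]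
  rw [lintegral_mul_exp_neg_sqNorm ht hmeas, ENNReal.ofReal_mul (by positivity)]
  congr 1
  obtain ⟨hI, hE⟩ := integrable_quadratic K
  have hscale : ∀ r : Fin n → ℂ, (((√(1 + t))⁻¹ • r) ⬝ᵥ K *ᵥ star ((√(1 + t))⁻¹ • r)).re =
      (1 + t)⁻¹ * (r ⬝ᵥ K *ᵥ star r).re := fun r => by
    rw [star_smul, Matrix.mulVec_smul, smul_dotProduct, dotProduct_smul, star_trivial, smul_smul,
      ← mul_inv, Real.mul_self_sqrt h1t.le, Complex.real_smul, Complex.re_ofReal_mul]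
  simp_rw [hscale]
  have hIre : Integrable (fun r : Fin n → ℂ => (r ⬝ᵥ K *ᵥ star r).re) (gaussianVec n) := hI.re
  have hEre : ∫ r : Fin n → ℂ, (r ⬝ᵥ K *ᵥ star r).re ∂gaussianVec n = K.trace.re := by
    rw [← hE]
    exact integral_re hI
  rw [← ofReal_integral_eq_lintegral_ofReal]
  · rw [integral_add (integrable_const _) (hIre.const_mul _), integral_const_mul, hEre]
    simp [div_eq_inv_mul]
  · exact (integrable_const _).add (hIre.const_mul _)
  · exact Filter.Eventually.of_forall fun r =>
      add_nonneg zero_le_one (mul_nonneg (inv_pos.mpr h1t).le (hnn r))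

/-! ### Row expansion of the Gram determinant -/

/-- Sylvester's identity `det (1 + A B) = det (1 + B A)`; the powers of `a` account for the two
matrix sizes. -/
lemma pow_mul_det_gram {m n : ℕ} {a : ℝ} (ha : 0 < a) (H : Matrix (Fin m) (Fin n) ℂ) :
    (a : ℂ) ^ n * (gram a H).det = (a : ℂ) ^ m * (gram a Hᴴ).det := by
  have ha' : (a : ℂ) ≠ 0 := by exact_mod_cast ha.ne'
  have h1 : gram a H = (a : ℂ) • (1 + ((a : ℂ)⁻¹ • H) * Hᴴ) := by
    rw [gram, smul_add, Matrix.smul_mul, smul_smul, mul_inv_cancel₀ ha', one_smul]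
  have h2 : gram a Hᴴ = (a : ℂ) • (1 + Hᴴ * ((a : ℂ)⁻¹ • H)) := by
    rw [gram, smul_add, Matrix.mul_smul, smul_smul, mul_inv_cancel₀ ha', one_smul,
      Matrix.conjTranspose_conjTranspose]
  rw [h1, h2, Matrix.det_smul, Matrix.det_smul, Matrix.det_one_add_mul_comm]
  simp only [Fintype.card_fin]
  ring

/-- In the companion matrix `a I + H† H`, whose size does not depend on the number of rows, adding
the row `r` is a rank-one update. The matrix determinant lemma applies there, and `pow_mul_det_gram`
carries the result back, leaving one extra factor `a`. -/
lemma gramDet_cons {m n : ℕ} {a : ℝ} (ha : 0 < a) (r : Fin n → ℂ) (R : Fin m → Fin n → ℂ) :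
    gramDet a (Matrix.of (Fin.cons r R : Fin (m + 1) → Fin n → ℂ)) =
      a * gramDet a (Matrix.of R) *
        (1 + (r ⬝ᵥ (gram a (Matrix.of R)ᴴ)⁻¹ *ᵥ star r).re) := by
  set K := gram a (Matrix.of R)ᴴ with hKdef
  have hK : K.PosDef := gram_posDef ha _
  have hKu : IsUnit K.det := hK.det_pos.ne'.isUnit
  have ha' : (a : ℂ) ≠ 0 := by exact_mod_cast ha.ne'
  set H : Matrix (Fin (m + 1)) (Fin n) ℂ := Matrix.of (Fin.cons r R) with hH
  have hgram : gram a Hᴴ = K + Matrix.replicateCol Unit (star r) * Matrix.replicateRow Unit r := by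
    rw [hKdef, gram, gram, add_assoc]
    congr 1
    ext i j
    simp only [Matrix.mul_apply, Matrix.add_apply, Matrix.conjTranspose_apply, hH,
      Matrix.of_apply, Fin.sum_univ_succ, Fin.cons_zero, Fin.cons_succ, star_star,
      Matrix.replicateCol_apply, Matrix.replicateRow_apply, Finset.univ_unique,
      Finset.sum_singleton, Pi.star_apply]
    ring
  have hdet : (gram a Hᴴ).det = K.det * (1 + r ⬝ᵥ K⁻¹ *ᵥ star r) := by
    have : gram a Hᴴ = K * (1 + Matrix.replicateCol Unit (K⁻¹ *ᵥ star r) *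
        Matrix.replicateRow Unit r) := by
      rw [hgram, mul_add, mul_one, Matrix.replicateCol_mulVec, ← Matrix.mul_assoc,
        ← Matrix.mul_assoc, Matrix.mul_nonsing_inv _ hKu, Matrix.one_mul]
    rw [this, Matrix.det_mul, Matrix.det_one_add_replicateCol_mul_replicateRow]
  have hfull : (gram a H).det = a * (gram a (Matrix.of R)).det * (1 + r ⬝ᵥ K⁻¹ *ᵥ star r) := by
    have h1 := pow_mul_det_gram ha H
    have h2 := pow_mul_det_gram ha (Matrix.of R)
    rw [hdet] at h1
    refine mul_left_cancel₀ (pow_ne_zero n ha') ?_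
    rw [h1, pow_succ]
    linear_combination (-(a : ℂ) * (1 + r ⬝ᵥ K⁻¹ *ᵥ star r)) * h2
  rw [← ofReal_gramDet ha (Matrix.of R), ← Complex.ofReal_mul] at hfull
  rw [gramDet, hfull, Complex.re_ofReal_mul, Complex.add_re, Complex.one_re]

/-- With `K = a I + R† R` and `M = a I + R R†`, one has `a K⁻¹ = 1 - K⁻¹ R† R` and `a M⁻¹ = 1 - M⁻¹
R R†`. The subtracted terms have equal traces by the push-through identity `R K⁻¹ = M⁻¹ R`, so only
the difference of sizes remains. -/
lemma trace_inv_gram {m n : ℕ} {a : ℝ} (ha : 0 < a) (R : Matrix (Fin m) (Fin n) ℂ) :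
    (a : ℂ) * ((gram a Rᴴ)⁻¹).trace = (n : ℂ) - m + a * ((gram a R)⁻¹).trace := by
  have hKu : IsUnit (gram a Rᴴ).det := (gram_posDef ha _).det_pos.ne'.isUnit
  have hMu : IsUnit (gram a R).det := (gram_posDef ha _).det_pos.ne'.isUnit
  have hcomm : gram a R * R = R * gram a Rᴴ := by
    simp only [gram, Matrix.add_mul, Matrix.mul_add, Matrix.mul_assoc,
      Matrix.conjTranspose_conjTranspose, Matrix.smul_mul, Matrix.mul_smul, Matrix.one_mul,
      Matrix.mul_one]
  have hinv : R * (gram a Rᴴ)⁻¹ = (gram a R)⁻¹ * R := by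
    calc R * (gram a Rᴴ)⁻¹ = (gram a R)⁻¹ * (gram a R * R) * (gram a Rᴴ)⁻¹ := by
          rw [← Matrix.mul_assoc, Matrix.nonsing_inv_mul _ hMu, Matrix.one_mul]
      _ = (gram a R)⁻¹ * R := by
          rw [hcomm, ← Matrix.mul_assoc, Matrix.mul_nonsing_inv_cancel_right _ _ hKu]
  have h1 : (a : ℂ) • (gram a Rᴴ)⁻¹ + (gram a Rᴴ)⁻¹ * (Rᴴ * R) = 1 := by
    have := Matrix.nonsing_inv_mul _ hKu
    conv at this => lhs; arg 2; rw [gram]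
    simpa [mul_add] using this
  have h2 : (a : ℂ) • (gram a R)⁻¹ + (gram a R)⁻¹ * (R * Rᴴ) = 1 := by
    have := Matrix.nonsing_inv_mul _ hMu
    conv at this => lhs; arg 2; rw [gram]
    simpa [mul_add] using this
  have h3 : ((gram a Rᴴ)⁻¹ * (Rᴴ * R)).trace = ((gram a R)⁻¹ * (R * Rᴴ)).trace := by
    rw [← Matrix.mul_assoc, Matrix.trace_mul_comm, ← Matrix.mul_assoc, hinv, Matrix.mul_assoc]
  have t1 := congrArg Matrix.trace h1
  have t2 := congrArg Matrix.trace h2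
  rw [Matrix.trace_add, Matrix.trace_smul, Matrix.trace_one, Fintype.card_fin, smul_eq_mul] at t1 t2
  rw [h3] at t1
  linear_combination t1 - t2

lemma gram_submatrix {m n : ℕ} (a : ℝ) (R : Fin (m + 1) → Fin n → ℂ) (i : Fin (m + 1)) :
    (gram a (Matrix.of R)).submatrix i.succAbove i.succAbove =
      gram a (Matrix.of fun j => R (i.succAbove j)) := by
  ext k l
  simp [gram, Matrix.mul_apply, Matrix.one_apply]

/-- The sum of the principal minors of size `m - 1` of `a I + R R†`. -/
def gramMinorSum {m n : ℕ} (a : ℝ) (R : Matrix (Fin m) (Fin n) ℂ) : ℝ :=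
  (gram a R).adjugate.trace.re

/-- Deleting row and column `i` of the Gram matrix amounts to deleting row `i` of `R`. The minors
are therefore Gram determinants of smaller matrices of the same kind, which lets the recursion for
the means close. -/
lemma gramMinorSum_succ {m n : ℕ} (a : ℝ) (R : Fin (m + 1) → Fin n → ℂ) :
    gramMinorSum a (Matrix.of R) =
      ∑ i : Fin (m + 1), gramDet a (Matrix.of fun j => R (i.succAbove j)) := by
  rw [gramMinorSum, Matrix.trace, Complex.re_sum]
  refine Finset.sum_congr rfl fun i _ => ?_
  rw [Matrix.diag_apply, Matrix.adjugate_fin_succ_eq_det_submatrix, gram_submatrix, gramDet,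
    Even.neg_one_pow ⟨(i : ℕ), rfl⟩, one_mul]

lemma gramMinorSum_nonneg {m n : ℕ} {a : ℝ} (ha : 0 < a) (R : Fin m → Fin n → ℂ) :
    0 ≤ gramMinorSum a (Matrix.of R) := by
  cases m with
  | zero => simp [gramMinorSum, Matrix.trace]
  | succ m =>
    rw [gramMinorSum_succ]
    exact Finset.sum_nonneg fun i _ => (gramDet_pos ha _).le

lemma gramDet_mul_trace {m n : ℕ} {a : ℝ} (ha : 0 < a) (R : Matrix (Fin m) (Fin n) ℂ) :
    a * gramDet a R * ((gram a Rᴴ)⁻¹).trace.re =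
      ((n : ℝ) - m) * gramDet a R + a * gramMinorSum a R := by
  have hMu : IsUnit (gram a R).det := (gram_posDef ha _).det_pos.ne'.isUnit
  have hadj : (gram a R).adjugate.trace = (gramDet a R : ℂ) * ((gram a R)⁻¹).trace := by
    rw [ofReal_gramDet ha, Matrix.inv_def, Matrix.trace_smul, smul_eq_mul, ← mul_assoc,
      Ring.mul_inverse_cancel _ hMu, one_mul]
  have h := congrArg (fun z => (gramDet a R : ℂ) * z) (trace_inv_gram ha R)
  have h' : ((a * gramDet a R : ℝ) : ℂ) * ((gram a Rᴴ)⁻¹).trace =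
      ((((n : ℝ) - m) * gramDet a R : ℝ) : ℂ) + (a : ℂ) * (gram a R).adjugate.trace := by
    rw [hadj]
    push_cast
    linear_combination h
  have h2 := congrArg Complex.re h'
  rwa [Complex.re_ofReal_mul, Complex.add_re, Complex.ofReal_re, Complex.re_ofReal_mul] at h2

/-- Averaging over the first row. -/
lemma lintegral_gramDet_cons {m n : ℕ} {a t : ℝ} (ha : 0 < a) (ht : 0 ≤ t)
    (R : Fin m → Fin n → ℂ) :
    ∫⁻ r, ENNReal.ofReal (gramDet a (Matrix.of (Fin.cons r R : Fin (m + 1) → Fin n → ℂ)) *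
        Real.exp (-(t * sqNorm r))) ∂gaussianVec n =
      ENNReal.ofReal (((1 + t) ^ n)⁻¹ * (a * gramDet a (Matrix.of R) +
        (((n : ℝ) - m) * gramDet a (Matrix.of R) + a * gramMinorSum a (Matrix.of R)) /
          (1 + t))) := by
  have hd := gramDet_pos ha (Matrix.of R)
  simp_rw [gramDet_cons ha, mul_assoc (a * gramDet a (Matrix.of R)),
    ENNReal.ofReal_mul (mul_pos ha hd).le]
  rw [lintegral_const_mul' _ _ ENNReal.ofReal_ne_top,
    lintegral_one_add_quadratic_mul_exp ht (gram_posDef ha _).inv.posSemidef,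
    ← ENNReal.ofReal_mul (mul_pos ha hd).le, ← gramDet_mul_trace ha]
  congr 1
  ring

/-! ### Coefficients of `(1 + z) ^ N * exp (a z)` and the derivative of `F` -/

/-- The coefficient of `z ^ m` in `(1 + z) ^ N * exp (a z)`. -/
def expChooseCoeff (N : ℕ) (a : ℝ) (m : ℕ) : ℝ :=
  ∑ k ∈ Finset.range (m + 1), (N.choose (m - k) : ℝ) * (a ^ k / (k.factorial : ℝ))

/-- The mean of `det (a I + H H†)` for an `m × N` matrix `H` of independent `CN(0,1)` entries. -/
def meanGramDet (N : ℕ) (a : ℝ) (m : ℕ) : ℝ := (m.factorial : ℝ) * expChooseCoeff N a m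

lemma expChooseCoeff_nonneg (N : ℕ) {a : ℝ} (ha : 0 ≤ a) (m : ℕ) : 0 ≤ expChooseCoeff N a m :=
  Finset.sum_nonneg fun _ _ => by positivity

lemma meanGramDet_nonneg (N : ℕ) {a : ℝ} (ha : 0 ≤ a) (m : ℕ) : 0 ≤ meanGramDet N a m :=
  mul_nonneg (by positivity) (expChooseCoeff_nonneg N ha m)

lemma meanGramDet_zero (N : ℕ) (a : ℝ) : meanGramDet N a 0 = 1 := by
  simp [meanGramDet, expChooseCoeff]

lemma sum_nat_mul_choose (N : ℕ) (a : ℝ) (m : ℕ) :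
    ∑ k ∈ Finset.range (m + 2), (k : ℝ) * ((N.choose (m + 1 - k) : ℝ) *
      (a ^ k / (k.factorial : ℝ))) = a * expChooseCoeff N a m := by
  rw [Finset.sum_range_succ', expChooseCoeff, Finset.mul_sum]
  simp only [Nat.cast_zero, zero_mul, add_zero]
  refine Finset.sum_congr rfl fun k _ => ?_
  have h : ((k + 1).factorial : ℝ) = (k + 1) * k.factorial := by
    rw [Nat.factorial_succ]; push_cast; ring
  have hk : (k.factorial : ℝ) ≠ 0 := by positivity
  have hk1 : (k : ℝ) + 1 ≠ 0 := by positivity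
  rw [Nat.add_sub_add_right, h]
  push_cast
  field_simp
  ring

lemma cast_choose_succ_mul (N j : ℕ) :
    ((j : ℝ) + 1) * (N.choose (j + 1) : ℝ) = ((N : ℝ) - j) * (N.choose j : ℝ) := by
  rcases le_or_gt j N with h | h
  · have := Nat.choose_succ_right_eq N j
    have h2 : ((N.choose (j + 1) * (j + 1) : ℕ) : ℝ) = ((N.choose j * (N - j) : ℕ) : ℝ) := by
      rw [this]
    push_cast [Nat.cast_sub h] at h2
    linarith
  · rw [Nat.choose_eq_zero_of_lt h, Nat.choose_eq_zero_of_lt (by omega)]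
    simp

/-- Coefficient form of `(1 + z) g' = (N + a (1 + z)) g` for `g = (1 + z)^N exp(a z)`. The last sum
is `a` times the preceding coefficient when `m` is positive, and it vanishes at `m = 0`, so no
predecessor index is needed. -/
lemma succ_mul_expChooseCoeff (N : ℕ) (a : ℝ) (m : ℕ) :
    ((m : ℝ) + 1) * expChooseCoeff N a (m + 1) =
      ((N : ℝ) - m + a) * expChooseCoeff N a m +
        ∑ k ∈ Finset.range (m + 1), (k : ℝ) * ((N.choose (m - k) : ℝ) *
          (a ^ k / (k.factorial : ℝ))) := by
  -- Split `m + 1 = (m + 1 - k) + k`: the first factor lowers the binomial index, the second lowers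
  -- the power of `a`.
  have h1 : ((m : ℝ) + 1) * expChooseCoeff N a (m + 1) =
      ∑ k ∈ Finset.range (m + 2), ((m : ℝ) + 1 - k) * ((N.choose (m + 1 - k) : ℝ) *
        (a ^ k / (k.factorial : ℝ))) + a * expChooseCoeff N a m := by
    rw [← sum_nat_mul_choose, ← Finset.sum_add_distrib, expChooseCoeff, Finset.mul_sum]
    exact Finset.sum_congr rfl fun k _ => by ring
  have h2 : ∑ k ∈ Finset.range (m + 2), ((m : ℝ) + 1 - k) * ((N.choose (m + 1 - k) : ℝ) *
        (a ^ k / (k.factorial : ℝ))) =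
      ∑ k ∈ Finset.range (m + 1), ((N : ℝ) - m + k) * ((N.choose (m - k) : ℝ) *
        (a ^ k / (k.factorial : ℝ))) := by
    rw [Finset.sum_range_succ]
    have h0 : ((m : ℝ) + 1 - ((m + 1 : ℕ) : ℝ)) = 0 := by push_cast; ring
    rw [h0, zero_mul, add_zero]
    refine Finset.sum_congr rfl fun k hk => ?_
    have hkm : k ≤ m := Nat.lt_succ_iff.mp (Finset.mem_range.mp hk)
    have hsub : m + 1 - k = (m - k) + 1 := by omega
    have hc := cast_choose_succ_mul N (m - k)
    rw [Nat.cast_sub hkm] at hc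
    rw [hsub, ← mul_assoc, ← mul_assoc]
    congr 1
    linear_combination hc
  rw [h1, h2, add_mul, add_right_comm]
  congr 1
  rw [expChooseCoeff, Finset.mul_sum, ← Finset.sum_add_distrib]
  exact Finset.sum_congr rfl fun k _ => by ring

lemma meanGramDet_succ (N : ℕ) (a : ℝ) (m : ℕ) :
    meanGramDet N a (m + 1) =
      ((N : ℝ) - m + a) * meanGramDet N a m + a * (m * meanGramDet N a (m - 1)) := by
  have h := succ_mul_expChooseCoeff N a m
  have hf : ((m + 1).factorial : ℝ) = m.factorial * (m + 1) := by
    rw [Nat.factorial_succ]; push_cast; ring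
  rw [meanGramDet, hf, mul_assoc, h]
  cases m with
  | zero => simp [meanGramDet, expChooseCoeff]
  | succ m =>
    rw [sum_nat_mul_choose, Nat.add_sub_cancel]
    simp only [meanGramDet, Nat.factorial_succ]
    push_cast
    ring

/-- Grouping the double sum by `j = k + n` exhibits `F` as the Taylor polynomial of degree below
`Ne` of `(1 + z)^N exp(a z)`, divided by that function. -/
lemma F_eq (Ne N : ℕ) (a z : ℝ) :
    F Ne (N + 1) a z = Real.exp (-(a * z)) * ((1 + z) ^ N)⁻¹ *
      ∑ j ∈ Finset.range Ne, z ^ j * expChooseCoeff N a j := by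
  have h : ∑ k ∈ Finset.range Ne, coeffA Ne (N + 1) k z / (k.factorial : ℝ) * (a * z) ^ k =
      ((1 + z) ^ N)⁻¹ * ∑ k ∈ Finset.range Ne, ∑ n ∈ Finset.range (Ne - k),
        (a ^ k / (k.factorial : ℝ) * z ^ k) * ((N.choose n : ℝ) * z ^ n) := by
    rw [Finset.mul_sum]
    refine Finset.sum_congr rfl fun k _ => ?_
    rw [coeffA, ← Finset.mul_sum, Nat.add_sub_cancel, mul_pow]
    ring
  rw [F, h, ← mul_assoc]
  congr 1
  rw [← Finset.sum_range_diag_flip Ne fun k n =>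
    (a ^ k / (k.factorial : ℝ) * z ^ k) * ((N.choose n : ℝ) * z ^ n)]
  refine Finset.sum_congr rfl fun j _ => ?_
  rw [expChooseCoeff, Finset.mul_sum]
  refine Finset.sum_congr rfl fun k hk => ?_
  have hkj : k ≤ j := Nat.lt_succ_iff.mp (Finset.mem_range.mp hk)
  have : z ^ j = z ^ k * z ^ (j - k) := by rw [← pow_add, Nat.add_sub_cancel' hkj]
  rw [this]
  ring

/-- The density of `Z₁` for an `(m + 1) × N` channel. -/
def snrDensity (m N : ℕ) (a t : ℝ) : ℝ :=
  t ^ m / (m.factorial : ℝ) * (Real.exp (-(a * t)) * (((1 + t) ^ (N + 1))⁻¹ *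
    (a * t * meanGramDet N a m + meanGramDet N a (m + 1))))

lemma snrDensity_nonneg (m N : ℕ) {a t : ℝ} (ha : 0 ≤ a) (ht : 0 ≤ t) :
    0 ≤ snrDensity m N a t := by
  have h1 := meanGramDet_nonneg N ha m
  have h2 := meanGramDet_nonneg N ha (m + 1)
  unfold snrDensity
  positivity

lemma hasDerivAt_inv_pow (N : ℕ) {z : ℝ} (hz : 0 ≤ z) :
    HasDerivAt (fun x : ℝ => ((1 + x) ^ N)⁻¹) (-(N : ℝ) * ((1 + z) ^ (N + 1))⁻¹) z := by
  have h1 : (1 + z) ≠ 0 := by positivity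
  have h : HasDerivAt (fun x : ℝ => ((1 + x) ^ N)⁻¹)
      (-(N * (1 + z) ^ (N - 1) * 1) / ((1 + z) ^ N) ^ 2) z :=
    (((hasDerivAt_id z).const_add 1).pow N).inv (pow_ne_zero N h1)
  refine h.congr_deriv ?_
  cases N with
  | zero => simp
  | succ N =>
    simp only [Nat.add_sub_cancel]
    field_simp
    ring

lemma hasDerivAt_F_term (m N : ℕ) (a : ℝ) {z : ℝ} (hz : 0 ≤ z) :
    HasDerivAt (fun x : ℝ => Real.exp (-(a * x)) * ((1 + x) ^ N)⁻¹ * x ^ m)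
      (Real.exp (-(a * z)) * ((1 + z) ^ (N + 1))⁻¹ *
        (-(a * (1 + z)) * z ^ m - N * z ^ m + m * z ^ (m - 1) * (1 + z))) z := by
  have h1 : (1 + z) ≠ 0 := by positivity
  have he : HasDerivAt (fun x : ℝ => Real.exp (-(a * x))) (Real.exp (-(a * z)) * (-(a * 1))) z :=
    (((hasDerivAt_id z).const_mul a).neg).exp
  refine ((he.mul (hasDerivAt_inv_pow N hz)).mul (hasDerivAt_pow m z)).congr_deriv ?_
  have hinv : ((1 + z) ^ N)⁻¹ = (1 + z) * ((1 + z) ^ (N + 1))⁻¹ := by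
    rw [pow_succ]; field_simp
  simp only [Pi.mul_apply, hinv]
  ring

/-- The derivative telescopes: by `meanGramDet_succ`, adding the next Taylor term replaces
`-snrDensity m` by exactly `-snrDensity (m + 1)`. -/
lemma hasDerivAt_F (m N : ℕ) (a : ℝ) {z : ℝ} (hz : 0 ≤ z) :
    HasDerivAt (F (m + 1) (N + 1) a) (-snrDensity m N a z) z := by
  have hF : ∀ m, F (m + 1) (N + 1) a = fun x => Real.exp (-(a * x)) * ((1 + x) ^ N)⁻¹ *
      ∑ j ∈ Finset.range (m + 1), x ^ j * expChooseCoeff N a j := fun m =>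
    funext fun x => F_eq (m + 1) N a x
  induction m with
  | zero =>
    rw [hF]
    have h := (hasDerivAt_F_term 0 N a hz).mul_const (expChooseCoeff N a 0)
    have hf : (fun x : ℝ => Real.exp (-(a * x)) * ((1 + x) ^ N)⁻¹ *
        ∑ j ∈ Finset.range (0 + 1), x ^ j * expChooseCoeff N a j) =
        fun x => Real.exp (-(a * x)) * ((1 + x) ^ N)⁻¹ * x ^ 0 * expChooseCoeff N a 0 := by
      funext x
      simp
    rw [hf]
    refine h.congr_deriv ?_
    · rw [snrDensity, meanGramDet_succ, meanGramDet]
      simp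
      ring
  | succ m ih =>
    have h := ih.add ((hasDerivAt_F_term (m + 1) N a hz).mul_const (expChooseCoeff N a (m + 1)))
    have hf : F (m + 1 + 1) (N + 1) a = F (m + 1) (N + 1) a + fun x : ℝ =>
        Real.exp (-(a * x)) * ((1 + x) ^ N)⁻¹ * x ^ (m + 1) * expChooseCoeff N a (m + 1) := by
      rw [hF, hF]
      funext x
      simp only [Pi.add_apply]
      rw [Finset.sum_range_succ _ (m + 1), mul_add]
      ring
    rw [hf]
    refine h.congr_deriv ?_
    · have hq : expChooseCoeff N a (m + 1) = meanGramDet N a (m + 1) / ((m + 1).factorial : ℝ) := by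
        rw [meanGramDet, mul_div_cancel_left₀ _ (by positivity)]
      have hr := meanGramDet_succ N a (m + 1)
      have hm : (m.factorial : ℝ) ≠ 0 := by positivity
      have hm1 : (m : ℝ) + 1 ≠ 0 := by positivity
      rw [Nat.add_sub_cancel] at hr
      rw [hq, snrDensity, snrDensity, hr, Nat.factorial_succ, Nat.add_sub_cancel]
      push_cast
      field_simp
      ring

lemma tendsto_F_atTop (m N : ℕ) {a : ℝ} (ha : 0 < a) :
    Filter.Tendsto (F m (N + 1) a) Filter.atTop (nhds 0) := by
  have hterm : ∀ j : ℕ, Filter.Tendsto (fun z : ℝ => z ^ j * Real.exp (-(a * z)))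
      Filter.atTop (nhds 0) := fun j => by
    have h := ((Real.tendsto_pow_mul_exp_neg_atTop_nhds_zero j).comp
      (Filter.tendsto_id.const_mul_atTop ha)).const_mul ((a ^ j)⁻¹)
    rw [mul_zero] at h
    refine h.congr fun z => ?_
    simp only [Function.comp_apply, id, mul_pow]
    field_simp
  have hsum : Filter.Tendsto (fun z : ℝ => ∑ j ∈ Finset.range m,
      z ^ j * Real.exp (-(a * z)) * expChooseCoeff N a j) Filter.atTop (nhds 0) := by
    have := tendsto_finsetSum (Finset.range m) fun j _ =>
      (hterm j).mul_const (expChooseCoeff N a j)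
    simpa using this
  refine squeeze_zero' ?_ ?_ hsum
  · filter_upwards [Filter.eventually_ge_atTop 0] with z hz
    rw [F_eq]
    have := fun j => expChooseCoeff_nonneg N ha.le j
    exact mul_nonneg (by positivity) (Finset.sum_nonneg fun j _ => by
      have := this j
      positivity)
  · filter_upwards [Filter.eventually_ge_atTop 0] with z hz
    rw [F_eq, mul_right_comm]
    have h1 : ((1 + z) ^ N)⁻¹ ≤ 1 := inv_le_one_of_one_le₀ (one_le_pow₀ (by linarith))
    have h2 : Real.exp (-(a * z)) * ∑ j ∈ Finset.range m, z ^ j * expChooseCoeff N a j =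
        ∑ j ∈ Finset.range m, z ^ j * Real.exp (-(a * z)) * expChooseCoeff N a j := by
      rw [Finset.mul_sum]
      exact Finset.sum_congr rfl fun j _ => by ring
    rw [h2]
    refine mul_le_of_le_one_right (Finset.sum_nonneg fun j _ => ?_) h1
    have := expChooseCoeff_nonneg N ha.le j
    positivity

lemma integral_snrDensity (m N : ℕ) {a z : ℝ} (ha : 0 < a) (hz : 0 ≤ z) :
    ∫ t in Set.Ioi z, snrDensity m N a t = F (m + 1) (N + 1) a z := by
  have h := integral_Ioi_of_hasDerivAt_of_nonpos' (a := z)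
    (fun x hx => hasDerivAt_F m N a (hz.trans hx))
    (fun x hx => neg_nonpos.mpr (snrDensity_nonneg m N ha.le (hz.trans (le_of_lt hx))))
    (tendsto_F_atTop (m + 1) N ha)
  rw [integral_neg] at h
  linarith

lemma F_zero (m N : ℕ) (a : ℝ) : F (m + 1) (N + 1) a 0 = 1 := by
  rw [F_eq, Finset.sum_range_succ']
  simp [expChooseCoeff]

/-! ### The mean of the Gram determinant -/

/-- Removing any row leaves a Gaussian matrix, so all `m` minors have the same mean. -/
lemma lintegral_gramMinorSum {m N : ℕ} {a : ℝ} (ha : 0 < a)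
    (h : ∀ k < m, ∫⁻ R, ENNReal.ofReal (gramDet a (Matrix.of R)) ∂gaussianMat k N =
      ENNReal.ofReal (meanGramDet N a k)) :
    ∫⁻ R, ENNReal.ofReal (gramMinorSum a (Matrix.of R)) ∂gaussianMat m N =
      ENNReal.ofReal (m * meanGramDet N a (m - 1)) := by
  cases m with
  | zero => simp [gramMinorSum, Matrix.trace]
  | succ m =>
    have hm : Measurable fun R : Fin m → Fin N → ℂ => ENNReal.ofReal (gramDet a (Matrix.of R)) :=
      (continuous_gramDet a).measurable.ennreal_ofReal
    simp_rw [gramMinorSum_succ, fun R : Fin (m + 1) → Fin N → ℂ => ENNReal.ofReal_sum_of_nonneg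
      (s := Finset.univ) (f := fun i : Fin (m + 1) =>
        gramDet a (Matrix.of fun j => R (i.succAbove j))) fun i _ => (gramDet_pos ha _).le]
    rw [lintegral_finsetSum]
    · have hi : ∀ i : Fin (m + 1), ∫⁻ R : Fin (m + 1) → Fin N → ℂ,
          ENNReal.ofReal (gramDet a (Matrix.of fun j => R (i.succAbove j))) ∂gaussianMat (m + 1) N =
          ENNReal.ofReal (meanGramDet N a m) := fun i => by
        rw [← h m (Nat.lt_succ_self m)]
        exact (measurePreserving_removeRow i).lintegral_comp hm
      simp_rw [hi]
      rw [Finset.sum_const, Finset.card_univ, Fintype.card_fin, nsmul_eq_mul, Nat.add_sub_cancel,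
        ENNReal.ofReal_mul (by positivity), ENNReal.ofReal_natCast]
    · exact fun i _ => hm.comp (measurePreserving_removeRow i).measurable

/-- The means up to size `m` are hypotheses because the case `t = 0` delivers the mean at size `m +
1`; this is the inductive step of `lintegral_gramDet`. -/
lemma lintegral_gramDet_mul_exp_of_mean {m N : ℕ} (hmN : m ≤ N) {a t : ℝ} (ha : 0 < a) (ht : 0 ≤ t)
    (h : ∀ k ≤ m, ∫⁻ R, ENNReal.ofReal (gramDet a (Matrix.of R)) ∂gaussianMat k N =
      ENNReal.ofReal (meanGramDet N a k)) :
    ∫⁻ H, ENNReal.ofReal (gramDet a (Matrix.of H) * Real.exp (-(t * sqNorm (H 0))))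
        ∂gaussianMat (m + 1) N =
      ENNReal.ofReal (((1 + t) ^ (N + 1))⁻¹ *
        (a * t * meanGramDet N a m + meanGramDet N a (m + 1))) := by
  have h1t : 0 < 1 + t := by linarith
  have hcG : Continuous fun H : Fin (m + 1) → Fin N → ℂ => gramDet a (Matrix.of H) :=
    continuous_gramDet a
  have hcN : Continuous fun H : Fin (m + 1) → Fin N → ℂ => sqNorm (H 0) :=
    continuous_sqNorm.comp (continuous_apply 0)
  have hmeas : Measurable fun H : Fin (m + 1) → Fin N → ℂ =>
      ENNReal.ofReal (gramDet a (Matrix.of H) * Real.exp (-(t * sqNorm (H 0)))) := by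
    fun_prop
  have hmp := (measurePreserving_piFinSuccAbove (fun _ : Fin (m + 1) => gaussianVec N) 0).symm
  have hmeas' := (hmeas.comp hmp.measurable).aemeasurable
    (μ := (gaussianVec N).prod (gaussianMat m N))
  rw [← hmp.lintegral_comp hmeas]
  refine (lintegral_prod_symm _ hmeas').trans ?_
  simp only [Function.comp_apply]
  have hcons : ∀ (r : Fin N → ℂ) (R : Fin m → Fin N → ℂ),
      (MeasurableEquiv.piFinSuccAbove (fun _ : Fin (m + 1) => (Fin N → ℂ)) 0).symm (r, R) =
        Fin.cons r R := fun r R => by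
    simp [MeasurableEquiv.piFinSuccAbove]
    rfl
  simp_rw [hcons, Fin.cons_zero]
  have hm1 : Measurable fun R : Fin m → Fin N → ℂ => ENNReal.ofReal (gramDet a (Matrix.of R)) :=
    (continuous_gramDet a).measurable.ennreal_ofReal
  -- Here `m ≤ N` enters: both coefficients must be nonnegative for `ENNReal.ofReal` to split over
  -- the sum.
  have hN : (0 : ℝ) ≤ (N : ℝ) - m := by
    have : (m : ℝ) ≤ N := by exact_mod_cast hmN
    linarith
  set c₁ : ℝ := ((1 + t) ^ N)⁻¹ * (a + ((N : ℝ) - m) / (1 + t)) with hc₁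
  set c₂ : ℝ := ((1 + t) ^ N)⁻¹ * (a / (1 + t)) with hc₂
  have hc₁0 : 0 ≤ c₁ := by positivity
  have hc₂0 : 0 ≤ c₂ := by positivity
  have hinner : ∀ R : Fin m → Fin N → ℂ,
      ∫⁻ r, ENNReal.ofReal (gramDet a (Matrix.of (Fin.cons r R : Fin (m + 1) → Fin N → ℂ)) *
        Real.exp (-(t * sqNorm r))) ∂gaussianVec N =
      ENNReal.ofReal c₁ * ENNReal.ofReal (gramDet a (Matrix.of R)) +
        ENNReal.ofReal c₂ * ENNReal.ofReal (gramMinorSum a (Matrix.of R)) := fun R => by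
    rw [lintegral_gramDet_cons ha ht, ← ENNReal.ofReal_mul hc₁0, ← ENNReal.ofReal_mul hc₂0,
      ← ENNReal.ofReal_add (mul_nonneg hc₁0 (gramDet_pos ha _).le)
        (mul_nonneg hc₂0 (gramMinorSum_nonneg ha R))]
    congr 1
    rw [hc₁, hc₂]
    ring
  simp_rw [hinner]
  rw [lintegral_add_left (hm1.const_mul _), lintegral_const_mul' _ _ ENNReal.ofReal_ne_top,
    lintegral_const_mul' _ _ ENNReal.ofReal_ne_top, h m le_rfl,
    lintegral_gramMinorSum ha fun k hk => h k hk.le, ← ENNReal.ofReal_mul hc₁0,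
    ← ENNReal.ofReal_mul hc₂0, ← ENNReal.ofReal_add
      (mul_nonneg hc₁0 (meanGramDet_nonneg N ha.le m))
      (mul_nonneg hc₂0 (mul_nonneg (by positivity) (meanGramDet_nonneg N ha.le (m - 1)))),
    meanGramDet_succ]
  congr 1
  rw [hc₁, hc₂]
  field_simp
  ring

lemma lintegral_gramDet {m N : ℕ} (hmN : m ≤ N) {a : ℝ} (ha : 0 < a) :
    ∫⁻ R, ENNReal.ofReal (gramDet a (Matrix.of R)) ∂gaussianMat m N =
      ENNReal.ofReal (meanGramDet N a m) := by
  induction m using Nat.strong_induction_on with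
  | _ m ih =>
    cases m with
    | zero => simp [gramDet, meanGramDet_zero]
    | succ m =>
      have := lintegral_gramDet_mul_exp_of_mean (by omega : m ≤ N) ha le_rfl
        fun k hk => ih k (by omega) (by omega)
      simpa using this

/-- The mean of `det (a I + H H†) exp (-|H† u|²)`, which depends on `u` through `|u|²` only. -/
lemma lintegral_gramDet_mul_exp {m N : ℕ} (hmN : m ≤ N) {a : ℝ} (ha : 0 < a)
    (u : Fin (m + 1) → ℂ) :
    ∫⁻ H, ENNReal.ofReal (gramDet a (Matrix.of H) *
        Real.exp (-sqNorm ((Matrix.of H)ᴴ *ᵥ u))) ∂gaussianMat (m + 1) N =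
      ENNReal.ofReal (((1 + sqNorm u) ^ (N + 1))⁻¹ *
        (a * sqNorm u * meanGramDet N a m + meanGramDet N a (m + 1))) := by
  rw [← lintegral_gramDet_mul_exp_of_mean hmN ha (sqNorm_nonneg u) fun k hk =>
    lintegral_gramDet (hk.trans hmN) ha]
  obtain ⟨U, hU, hUu⟩ := exists_unitary_align u
  have hU' : U * Uᴴ = 1 := mul_eq_one_comm.mp hU
  have hcN : Continuous fun H : Fin (m + 1) → Fin N → ℂ => sqNorm ((Matrix.of H)ᴴ *ᵥ u) := by
    have h : Continuous fun H : Fin (m + 1) → Fin N → ℂ =>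
      (Matrix.of H : Matrix (Fin (m + 1)) (Fin N) ℂ) := continuous_id
    exact continuous_sqNorm.comp (h.matrix_conjTranspose.matrix_mulVec continuous_const)
  have hcG : Continuous fun H : Fin (m + 1) → Fin N → ℂ => gramDet a (Matrix.of H) :=
    continuous_gramDet a
  rw [← (measurePreserving_unitary_mul (n := N) U hU).lintegral_comp (by fun_prop)]
  refine lintegral_congr fun H => ?_
  have hdet : gramDet a (U * Matrix.of H) = gramDet a (Matrix.of H) := by
    have : gram a (U * Matrix.of H) = U * gram a (Matrix.of H) * Uᴴ := by
      rw [gram, gram, Matrix.mul_add, Matrix.add_mul, Matrix.conjTranspose_mul, Matrix.mul_smul,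
        Matrix.mul_one, Matrix.smul_mul, hU']
      simp only [Matrix.mul_assoc]
    rw [gramDet, this, Matrix.det_mul, Matrix.det_mul, mul_right_comm, ← Matrix.det_mul,
      hU', Matrix.det_one, one_mul, gramDet]
  have hvec : sqNorm ((U * Matrix.of H)ᴴ *ᵥ u) = sqNorm u * sqNorm (H 0) := by
    rw [Matrix.conjTranspose_mul, ← Matrix.mulVec_mulVec, hUu]
    simp only [sqNorm, Matrix.mulVec_single, Finset.mul_sum]
    refine Finset.sum_congr rfl fun j _ => ?_
    simp only [Pi.smul_apply, Matrix.col_apply, Matrix.conjTranspose_apply, Matrix.of_apply,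
      MulOpposite.smul_eq_mul_unop, MulOpposite.unop_op, norm_mul, norm_star, mul_pow,
      Complex.norm_real, Real.norm_eq_abs, sq_abs]
    rw [Real.sq_sqrt (Finset.sum_nonneg fun _ _ => by positivity), mul_comm]
  simp only [Equiv.apply_symm_apply, hdet, hvec]

/-! ### The law of the quadratic form -/

/-- Polar coordinates in real dimension `2 m + 2` give the weight `r^(2 m + 1) dr`, which becomes
`t^m dt / 2` under `t = r²`. -/
lemma exists_integral_sqNorm (m : ℕ) :
    ∃ c : ℝ, ∀ f : ℝ → ℝ,
      ∫ u : Fin (m + 1) → ℂ, f (sqNorm u) = c * ∫ t in Set.Ioi (0 : ℝ), t ^ m * f t := by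
  -- The function space carries the sup norm, so the integral is moved to `EuclideanSpace`, where
  -- `sqNorm` is the squared norm.
  let e : (Fin (m + 1) → ℂ) ≃L[ℝ] EuclideanSpace ℂ (Fin (m + 1)) :=
    (PiLp.continuousLinearEquiv 2 ℝ (fun _ : Fin (m + 1) => ℂ)).symm
  let μ : Measure (EuclideanSpace ℂ (Fin (m + 1))) := volume.map e
  have hμ : μ.IsAddHaarMeasure := e.isAddHaarMeasure_map volume
  have he : ∀ u, sqNorm u = ‖e u‖ ^ 2 := fun u => by
    rw [EuclideanSpace.norm_sq_eq]
    rfl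
  have hfr : Module.finrank ℝ (EuclideanSpace ℂ (Fin (m + 1))) - 1 = 2 * m + 1 := by
    rw [← e.toLinearEquiv.finrank_eq, Module.finrank_pi_fintype]
    simp [Complex.finrank_real_complex]
    omega
  refine ⟨Module.finrank ℝ (EuclideanSpace ℂ (Fin (m + 1))) * μ.real (Metric.ball 0 1) * (1 / 2),
    fun f => ?_⟩
  have h1 : ∫ u : Fin (m + 1) → ℂ, f (sqNorm u) = ∫ x, f (‖x‖ ^ 2) ∂μ := by
    simp_rw [he]
    exact (e.toHomeomorph.measurableEmbedding.integral_map (fun x => f (‖x‖ ^ 2))).symm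
  have h2 := integral_comp_rpow_Ioi_of_pos (g := fun t : ℝ => t ^ m * f t) (p := 2) (by norm_num)
  have h3 : ∫ y in Set.Ioi (0 : ℝ), y ^ (2 * m + 1) • f (y ^ 2) =
      (1 / 2) * ∫ t in Set.Ioi (0 : ℝ), t ^ m * f t := by
    rw [← h2, ← integral_const_mul]
    refine setIntegral_congr_fun measurableSet_Ioi fun y _ => ?_
    have hy1 : y ^ ((2 : ℝ) - 1) = y := by norm_num
    simp only [hy1, Real.rpow_two, smul_eq_mul]
    ring
  rw [h1, integral_fun_norm_addHaar μ (fun y => f (y ^ 2)), hfr, h3, nsmul_eq_mul, smul_eq_mul]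
  ring

/-- Tonelli is used twice: first `h` is replaced by `u` for fixed `H`, then the order is swapped and
`H` is averaged for fixed `u`. -/
lemma measure_quadForm {m N : ℕ} (hmN : m ≤ N) {a : ℝ} (ha : 0 < a) {s : Set ℝ}
    (hs : MeasurableSet s) :
    ((gaussianVec (m + 1)).prod (gaussianMat (m + 1) N))
        {p | quadForm a p.1 (Matrix.of p.2) ∈ s} =
      ∫⁻ u : Fin (m + 1) → ℂ, ENNReal.ofReal (s.indicator (fun t => (Real.pi⁻¹) ^ (m + 1) *
        Real.exp (-(a * t)) * (((1 + t) ^ (N + 1))⁻¹ *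
          (a * t * meanGramDet N a m + meanGramDet N a (m + 1)))) (sqNorm u)) := by
  have hq : Measurable fun p : (Fin (m + 1) → ℂ) × (Fin (m + 1) → Fin N → ℂ) =>
      quadForm a p.1 (Matrix.of p.2) := (continuous_quadForm ha).measurable
  have hset : MeasurableSet {p : (Fin (m + 1) → ℂ) × (Fin (m + 1) → Fin N → ℂ) |
      quadForm a p.1 (Matrix.of p.2) ∈ s} := hq hs
  have hind : Measurable (s.indicator (1 : ℝ → ENNReal)) := measurable_one.indicator hs
  have hc := continuous_sqNorm (n := m + 1)
  have hcG : Continuous fun H : Fin (m + 1) → Fin N → ℂ => gramDet a (Matrix.of H) :=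
    continuous_gramDet a
  have hcGp : Continuous fun p : (Fin (m + 1) → Fin N → ℂ) × (Fin (m + 1) → ℂ) =>
      gramDet a (Matrix.of p.1) := hcG.comp continuous_fst
  have hcN : Continuous fun p : (Fin (m + 1) → Fin N → ℂ) × (Fin (m + 1) → ℂ) =>
      sqNorm ((Matrix.of p.1)ᴴ *ᵥ p.2) := by
    have h : Continuous fun p : (Fin (m + 1) → Fin N → ℂ) × (Fin (m + 1) → ℂ) =>
      (Matrix.of p.1 : Matrix (Fin (m + 1)) (Fin N) ℂ) := continuous_fst
    exact continuous_sqNorm.comp (h.matrix_conjTranspose.matrix_mulVec continuous_snd)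
  rw [← lintegral_indicator_one hset]
  refine (lintegral_prod_symm _ (measurable_one.indicator hset).aemeasurable).trans ?_
  have h1 : ∀ H : Fin (m + 1) → Fin N → ℂ, ∫⁻ h,
      {p : (Fin (m + 1) → ℂ) × (Fin (m + 1) → Fin N → ℂ) |
        quadForm a p.1 (Matrix.of p.2) ∈ s}.indicator
          (1 : (Fin (m + 1) → ℂ) × (Fin (m + 1) → Fin N → ℂ) → ENNReal) (h, H)
        ∂gaussianVec (m + 1) =
      ∫⁻ u : Fin (m + 1) → ℂ, s.indicator (1 : ℝ → ENNReal) (sqNorm u) *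
        ENNReal.ofReal ((Real.pi⁻¹) ^ (m + 1) * Real.exp (-(a * sqNorm u)) *
        (gramDet a (Matrix.of H) * Real.exp (-sqNorm ((Matrix.of H)ᴴ *ᵥ u)))) := fun H => by
    rw [← lintegral_quadForm_gaussianVec ha _ hind]
    rfl
  simp_rw [h1]
  rw [lintegral_lintegral_swap]
  · refine lintegral_congr fun u => ?_
    have hpos : 0 ≤ (Real.pi⁻¹) ^ (m + 1) * Real.exp (-(a * sqNorm u)) := by positivity
    simp_rw [ENNReal.ofReal_mul hpos, ← mul_assoc]
    rw [lintegral_const_mul' _ _ (by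
      refine ENNReal.mul_ne_top ?_ ENNReal.ofReal_ne_top
      by_cases hu : sqNorm u ∈ s <;> simp [hu]),
      lintegral_gramDet_mul_exp hmN ha]
    by_cases hu : sqNorm u ∈ s
    · simp only [Set.indicator_of_mem hu, Pi.one_apply, one_mul]
      rw [← ENNReal.ofReal_mul hpos, ← mul_assoc]
    · simp [Set.indicator_of_notMem hu]
  · refine Measurable.aemeasurable (Measurable.mul ?_ ?_)
    · exact hind.comp (hc.measurable.comp measurable_snd)
    · have : Continuous fun p : (Fin (m + 1) → Fin N → ℂ) × (Fin (m + 1) → ℂ) =>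
          sqNorm p.2 := hc.comp continuous_snd
      fun_prop

lemma exists_measureReal_quadForm {m N : ℕ} (hmN : m ≤ N) {a : ℝ} (ha : 0 < a) :
    ∃ c : ℝ, ∀ s : Set ℝ, MeasurableSet s →
      ((gaussianVec (m + 1)).prod (gaussianMat (m + 1) N)).real
        {p | quadForm a p.1 (Matrix.of p.2) ∈ s} =
      c * ∫ t in Set.Ioi (0 : ℝ) ∩ s, snrDensity m N a t := by
  obtain ⟨c, hc⟩ := exists_integral_sqNorm m
  refine ⟨c * ((Real.pi⁻¹) ^ (m + 1) * m.factorial), fun s hs => ?_⟩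
  set w : ℝ → ℝ := fun t => (Real.pi⁻¹) ^ (m + 1) * Real.exp (-(a * t)) * (((1 + t) ^ (N + 1))⁻¹ *
    (a * t * meanGramDet N a m + meanGramDet N a (m + 1))) with hw
  have hwm : Measurable w := by
    rw [hw]
    fun_prop
  have hw0 : ∀ t, 0 ≤ t → 0 ≤ w t := fun t ht => by
    have h1 := meanGramDet_nonneg N ha.le m
    have h2 := meanGramDet_nonneg N ha.le (m + 1)
    simp only [hw]
    positivity
  have hi0 : ∀ u : Fin (m + 1) → ℂ, 0 ≤ s.indicator w (sqNorm u) := fun u => by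
    by_cases hu : sqNorm u ∈ s
    · rw [Set.indicator_of_mem hu]
      exact hw0 _ (sqNorm_nonneg u)
    · rw [Set.indicator_of_notMem hu]
  rw [Measure.real, measure_quadForm hmN ha hs, ← integral_eq_lintegral_of_nonneg_ae
    (Filter.Eventually.of_forall hi0)
    ((hwm.indicator hs).comp continuous_sqNorm.measurable).aestronglyMeasurable,
    hc (s.indicator w), mul_assoc c, ← setIntegral_indicator hs]
  congr 1
  rw [← integral_const_mul]
  congr 1
  funext t
  by_cases ht : t ∈ s
  · simp only [Set.indicator_of_mem ht, snrDensity, hw]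
    field_simp
  · simp [Set.indicator_of_notMem ht]

lemma measureReal_quadForm {m N : ℕ} (hmN : m ≤ N) {a : ℝ} (ha : 0 < a) {s : Set ℝ}
    (hs : MeasurableSet s) :
    ((gaussianVec (m + 1)).prod (gaussianMat (m + 1) N)).real
        {p | quadForm a p.1 (Matrix.of p.2) ∈ s} =
      ∫ t in Set.Ioi (0 : ℝ) ∩ s, snrDensity m N a t := by
  obtain ⟨c, hc⟩ := exists_measureReal_quadForm hmN ha
  -- Taking the whole line identifies the constant as 1, since the density integrates to `F 0 = 1`.
  have h1 := hc Set.univ MeasurableSet.univ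
  rw [Set.inter_univ, integral_snrDensity m N ha le_rfl, F_zero, mul_one] at h1
  simp only [Set.mem_univ, Set.ofPred_true, probReal_univ] at h1
  rw [hc s hs, ← h1, one_mul]

/-! ### The law of the channels -/

lemma measurePreserving_curry (m n : ℕ) :
    MeasurePreserving (MeasurableEquiv.curry (Fin m) (Fin n) ℂ)
      (Measure.pi fun _ : Fin m × Fin n => stdComplexGaussian) (gaussianMat m n) := by
  refine ⟨MeasurableEquiv.measurable _, ?_⟩
  have h := Measure.infinitePi_map_curry (ι := Fin m) (κ := Fin n)
    fun _ _ => stdComplexGaussian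
  simpa only [Measure.infinitePi_eq_pi] using h

lemma IsRayleighFading.map_eq {Ω : Type*} [MeasurableSpace Ω] {P : Measure Ω}
    [IsProbabilityMeasure P] {m N : ℕ} {hve : Ω → Fin m → ℂ}
    {Hme : Ω → Matrix (Fin m) (Fin (N + 1)) ℂ} (hf : IsRayleighFading P hve Hme)
    {G : Matrix (Fin (N + 1)) (Fin N) ℂ} (hG : Gᴴ * G = 1) :
    AEMeasurable (fun ω => (hve ω, fun i => Hme ω i ᵥ* G)) P ∧
      P.map (fun ω => (hve ω, fun i => Hme ω i ᵥ* G)) = (gaussianVec m).prod (gaussianMat m N) := by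
  have hae : ∀ e, AEMeasurable (channelEntry hve Hme e) P := fun e => (hf.hasLaw e).aemeasurable
  have hmap := (iIndepFun_iff_map_fun_eq_pi_map hae).mp hf.indep
  simp_rw [fun e => (hf.hasLaw e).map_eq] at hmap
  have hentry : AEMeasurable (fun ω e => channelEntry hve Hme e ω) P := aemeasurable_pi_lambda _ hae
  have hrows : MeasurePreserving (fun H : Fin m → Fin (N + 1) → ℂ => fun i => H i ᵥ* G)
      (gaussianMat m (N + 1)) (gaussianMat m N) :=
    measurePreserving_pi _ _ fun _ => measurePreserving_vecMul G hG
  -- The family of all entries is split into vector and matrix parts, the matrix part is curried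
  -- into rows, and each row is multiplied by `G`.
  have hmp := ((MeasurePreserving.id (gaussianVec m)).prod
    (hrows.comp (measurePreserving_curry m (N + 1)))).comp
    (measurePreserving_sumPiEquivProdPi fun _ : Fin m ⊕ (Fin m × Fin (N + 1)) => stdComplexGaussian)
  refine ⟨hmp.measurable.comp_aemeasurable hentry, ?_⟩
  have h := hmp.map_eq
  rw [← hmap, AEMeasurable.map_map_of_aemeasurable hmp.measurable.aemeasurable hentry] at h
  exact h

lemma IsRayleighFading.measureReal_quadForm {Ω : Type*} [MeasurableSpace Ω] {P : Measure Ω}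
    [IsProbabilityMeasure P] {m N : ℕ} (hmN : m ≤ N) {hve : Ω → Fin (m + 1) → ℂ}
    {Hme : Ω → Matrix (Fin (m + 1)) (Fin (N + 1)) ℂ} (hf : IsRayleighFading P hve Hme)
    {G : Matrix (Fin (N + 1)) (Fin N) ℂ} (hG : Gᴴ * G = 1) {a : ℝ} (ha : 0 < a) {s : Set ℝ}
    (hs : MeasurableSet s) :
    P.real {ω | quadForm a (hve ω) (Hme ω * G) ∈ s} =
      ∫ t in Set.Ioi (0 : ℝ) ∩ s, snrDensity m N a t := by
  obtain ⟨hae, hmap⟩ := hf.map_eq hG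
  have hset : MeasurableSet {p : (Fin (m + 1) → ℂ) × (Fin (m + 1) → Fin N → ℂ) |
      quadForm a p.1 (Matrix.of p.2) ∈ s} := (continuous_quadForm ha).measurable hs
  rw [← UplinkSecrecy.measureReal_quadForm hmN ha hs, ← hmap]
  exact congrArg ENNReal.toReal (Measure.map_apply_of_aemeasurable hae hset).symm

/-! ### The wiretap capacity -/

lemma quadForm_nonneg {m n : ℕ} {a : ℝ} (ha : 0 < a) (h : Fin m → ℂ)
    (H : Matrix (Fin m) (Fin n) ℂ) : 0 ≤ quadForm a h H :=
  (Complex.le_def.mp ((gram_posDef ha H).inv.posSemidef.dotProduct_mulVec_nonneg h)).1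

/-- Factoring `Pm / N` out of the noise covariance leaves `gram` with parameter `a₁`. The remaining
determinant is that of the identity plus a rank-one matrix. -/
lemma wiretapCapacity_eq {m N : ℕ} (hN : 1 ≤ N) (B₁ Pv : ℝ) {Pm : ℝ} (hPm : 0 < Pm) {σve : ℝ}
    (ha : 0 < a₁ (N + 1) Pm σve) (h : Fin m → ℂ) (H : Matrix (Fin m) (Fin N) ℂ) :
    wiretapCapacity (N + 1) B₁ Pv Pm σve h H =
      B₁ * Real.logb 2 (1 + Pv * N / Pm * quadForm (a₁ (N + 1) Pm σve) h H) := by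
  set a := a₁ (N + 1) Pm σve with haa
  have hN0 : (N : ℝ) ≠ 0 := by
    have : (0 : ℝ) < N := by exact_mod_cast hN
    exact this.ne'
  have hc : Pm / (((N + 1 : ℕ) : ℝ) - 1) = Pm / N := by push_cast; ring
  have hσ : σve ^ 2 = Pm / N * a := by
    rw [haa, a₁]
    push_cast
    field_simp
    ring
  have hM : ((σve ^ 2 : ℝ) : ℂ) • (1 : Matrix (Fin m) (Fin m) ℂ) +
      ((Pm / N : ℝ) : ℂ) • (H * Hᴴ) = ((Pm / N : ℝ) : ℂ) • gram a H := by
    rw [gram, smul_add, smul_smul, ← Complex.ofReal_mul, hσ]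
  have hinv : (((Pm / N : ℝ) : ℂ) • gram a H)⁻¹ = ((N / Pm : ℝ) : ℂ) • (gram a H)⁻¹ := by
    refine Matrix.inv_eq_left_inv ?_
    have : (N : ℝ) / Pm * (Pm / N) = 1 := by field_simp
    rw [Matrix.smul_mul, Matrix.mul_smul, smul_smul,
      Matrix.nonsing_inv_mul _ (gram_posDef ha H).det_pos.ne'.isUnit, ← Complex.ofReal_mul, this,
      Complex.ofReal_one, one_smul]
  rw [wiretapCapacity, hc, hM, hinv]
  congr 2
  have hX : (Pv : ℂ) • (Matrix.vecMulVec h (star h) * (((N / Pm : ℝ) : ℂ) • (gram a H)⁻¹)) =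
      Matrix.replicateCol Unit h *
        Matrix.replicateRow Unit (((Pv * N / Pm : ℝ) : ℂ) • (star h ᵥ* (gram a H)⁻¹)) := by
    rw [Matrix.mul_smul, smul_smul, Matrix.vecMulVec_mul, ← Complex.ofReal_mul, ← mul_div_assoc]
    ext i j
    simp [Matrix.vecMulVec_apply, Matrix.mul_apply]
    ring
  rw [hX, Matrix.det_one_add_replicateCol_mul_replicateRow, smul_dotProduct,
    ← Matrix.dotProduct_mulVec, Complex.add_re, Complex.one_re, smul_eq_mul, Complex.re_ofReal_mul]
  rfl

end

end UplinkSecrecy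

/-! ### Secrecy outage as a tail event of `Z₁` -/

theorem proposition4 {Ω : Type*} [MeasurableSpace Ω] (P : MeasureTheory.Measure Ω)
    [MeasureTheory.IsProbabilityMeasure P] (Ne Nm : ℕ) (hNe : 1 ≤ Ne) (hNm : Ne < Nm)
    (B₁ Pv Pm σvm σve : ℝ) (hB₁ : 0 < B₁) (hPv : 0 < Pv) (hPm : 0 < Pm)
    (hσvm : 0 < σvm) (hσve : 0 < σve)
    (hvm : Fin Nm → ℂ) (Hmm : Matrix (Fin Nm) (Fin Nm) ℂ)
    (G : Matrix (Fin Nm) (Fin (Nm - 1)) ℂ) (hG : UplinkSecrecy.IsNoisePrecoder hvm Hmm G)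
    (hve : Ω → Fin Ne → ℂ) (Hme : Ω → Matrix (Fin Ne) (Fin Nm) ℂ)
    (hfading : UplinkSecrecy.IsRayleighFading P hve Hme) :
    let H₁ : Ω → Matrix (Fin Ne) (Fin (Nm - 1)) ℂ := fun ω => Hme ω * G
    let Cv : ℝ := UplinkSecrecy.mainCapacity B₁ Pv σvm hvm
    let Ce : Ω → ℝ := fun ω => UplinkSecrecy.wiretapCapacity Nm B₁ Pv Pm σve (hve ω) (H₁ ω)
    let a : ℝ := UplinkSecrecy.a₁ Nm Pm σve
    let Z₁ : Ω → ℝ := fun ω => UplinkSecrecy.quadForm a (hve ω) (H₁ ω)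
    let F : ℝ → ℝ := UplinkSecrecy.F Ne Nm a
    let φ : ℝ → ℝ := UplinkSecrecy.φ₁ Nm B₁ Pv Pm Cv
    (∀ z : ℝ, 0 ≤ z → P.real {ω | z < Z₁ ω} = F z ∧ P.real {ω | z ≤ Z₁ ω} = F z) ∧
    ∀ Ru : ℝ, 0 ≤ Ru → Ru ≤ Cv →
      UplinkSecrecy.outageProb P Cv Ce Ru = P.real {ω | Cv - Ru ≤ Ce ω} ∧
      UplinkSecrecy.outageProb P Cv Ce Ru = F (φ Ru) ∧
      UplinkSecrecy.effectiveSecrecyRate P Cv Ce Ru = (1 - F (φ Ru)) * Ru := by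
  intro H₁ Cv Ce a Z₁ F φ
  obtain ⟨m, rfl⟩ : ∃ m, Ne = m + 1 := ⟨Ne - 1, by omega⟩
  obtain ⟨N, rfl⟩ : ∃ N, Nm = N + 1 := ⟨Nm - 1, by omega⟩
  have hmN : m ≤ N := by omega
  have hN : 1 ≤ N := by omega
  have hN0 : (0 : ℝ) < N := by exact_mod_cast hN
  have ha : 0 < a := by
    simp only [a, UplinkSecrecy.a₁]
    push_cast
    rw [add_sub_cancel_right]
    positivity
  have hlt : ∀ z : ℝ, 0 ≤ z → P.real {ω | z < Z₁ ω} = F z := fun z hz => by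
    have h := hfading.measureReal_quadForm hmN hG.orthonormal ha (measurableSet_Ioi (a := z))
    rw [Set.Ioi_inter_Ioi, max_eq_right hz, UplinkSecrecy.integral_snrDensity m N ha hz] at h
    exact h
  have hle : ∀ z : ℝ, 0 ≤ z → P.real {ω | z ≤ Z₁ ω} = F z := fun z hz => by
    have h := hfading.measureReal_quadForm hmN hG.orthonormal ha (measurableSet_Ici (a := z))
    -- The law has a density, so including the endpoint changes nothing.
    have hae : (Set.Ioi (0 : ℝ) ∩ Set.Ici z : Set ℝ) =ᵐ[volume] (Set.Ioi 0 ∩ Set.Ioi z : Set ℝ) :=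
      (Filter.EventuallyEq.refl _ _).inter Ioi_ae_eq_Ici.symm
    rw [setIntegral_congr_set hae, Set.Ioi_inter_Ioi, max_eq_right hz,
      UplinkSecrecy.integral_snrDensity m N ha hz] at h
    exact h
  refine ⟨fun z hz => ⟨hlt z hz, hle z hz⟩, fun Ru hRu hRuC => ?_⟩
  have hout : UplinkSecrecy.outageProb P Cv Ce Ru = P.real {ω | Cv - Ru ≤ Ce ω} := by
    rw [UplinkSecrecy.outageProb]
    congr 1
    ext ω
    -- Since `0 ≤ Ru`, the positive part does not affect the comparison with `Ru`.
    simp only [Set.mem_ofPred_eq, UplinkSecrecy.secrecyRate, max_le_iff, hRu, and_true]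
    constructor <;> intro h <;> linarith
  -- The tail formula holds only at nonnegative thresholds, which is where `Ru ≤ Cv` is needed.
  have hφ : 0 ≤ φ Ru := by
    simp only [φ, UplinkSecrecy.φ₁]
    push_cast
    rw [add_sub_cancel_right]
    have h1 : (1 : ℝ) ≤ 2 ^ ((Cv - Ru) / B₁) :=
      Real.one_le_rpow one_le_two (div_nonneg (sub_nonneg.mpr hRuC) hB₁.le)
    exact mul_nonneg (by positivity) (sub_nonneg.mpr h1)
  have hset : {ω | Cv - Ru ≤ Ce ω} = {ω | φ Ru ≤ Z₁ ω} := by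
    ext ω
    have hZ : 0 ≤ Z₁ ω := UplinkSecrecy.quadForm_nonneg ha _ _
    have hpos : 0 < 1 + Pv * N / Pm * Z₁ ω := by positivity
    have hCe : Ce ω = B₁ * Real.logb 2 (1 + Pv * N / Pm * Z₁ ω) :=
      UplinkSecrecy.wiretapCapacity_eq hN B₁ Pv hPm ha (hve ω) (H₁ ω)
    have hφe : φ Ru = (2 ^ ((Cv - Ru) / B₁) - 1) / (Pv * N / Pm) := by
      simp only [φ, UplinkSecrecy.φ₁]
      push_cast
      rw [add_sub_cancel_right]
      field_simp
    simp only [Set.mem_ofPred_eq]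
    rw [hCe, ← div_le_iff₀' hB₁, Real.le_logb_iff_rpow_le one_lt_two hpos, hφe,
      div_le_iff₀' (by positivity), sub_le_iff_le_add']
  have hF : UplinkSecrecy.outageProb P Cv Ce Ru = F (φ Ru) := by
    rw [hout, hset, hle _ hφ]
  exact ⟨hout, hF, by rw [UplinkSecrecy.effectiveSecrecyRate, hF]⟩
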